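/- Let $\mathbb{K}$ be a field, $d,s\ge 1$, and $\underline{Y}=(Y_1,\ldots,Y_d)\in(\mathbb{K}^{s\times s})^d$. View a matrix in $\mathbb{K}^{sm\times sm}$ as an $m\times m$ matrix with blocks in $\mathbb{K}^{s\times s}$, and let $\odot_s$ denote the product of such block matrices over the tensor algebra of $\mathbb{K}^{s\times s}$, i.e. $(P\odot_s Q)_{ij}=\sum_{k}P_{ik}\otimes Q_{kj}$. For a word $\omega=g_{i_1}\cdots g_{i_\ell}$ in the free monoid $\mathcal{G}_d$ on $g_1,\dots,g_d$, put $|\omega|=\ell$ and $\underline{X}^{\odot_s\omega}=X_{i_1}\odot_s\cdots\odot_s X_{i_\ell}$ (the identity for the empty word). The nilpotent ball $Nilp(\underline{Y})$ consists of all $\underline{X}\in(\mathbb{K}^{sm\times sm})^d$, $m\ge1$, for which there is $\kappa\in\mathbb{N}$ with $(\underline{X}-I_m\otimes\underline{Y})^{\odot_s\omega}=0$ for all words $\omega$ with $|\omega|\ge\kappa$. For every $\omega\in\mathcal{G}_d$ let $f_\omega:(\mathbb{K}^{s\times s})^{|\omega|}\to\mathbb{K}^{s\times s}$ be an $|\omega|$-linear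 map, equivalently a linear map on $(\mathbb{K}^{s\times s})^{\otimes|\omega|}$, and let $f$ be the generalized nc power series $$f(\underline{X})=\sum_{\omega\in\mathcal{G}_d}(\underline{X}-I_m\otimes\underline{Y})^{\odot_s\omega}f_\omega ,$$ where $f_\omega$ is applied entrywise; the sum is finite for $\underline{X}\in Nilp(\underline{Y})$. Suppose that $f$ admits the nc Fornasini--Marchesini realization centred at $\underline{Y}$ and described by $(L;D,C,\underline{\mathbf{A}},\underline{\mathbf{B}})$, where $D\in\mathbb{K}^{s\times s}$, $C\in\mathbb{K}^{s\times L}$, and $\mathbf{A}_k:\mathbb{K}^{s\times s}\to\mathbb{K}^{L\times L}$, $\mathbf{B}_k:\mathbb{K}^{s\times s}\to\mathbb{K}^{L\times s}$ ($1\le k\le d$) are linear; that is, $f_\emptyset=D$ and $$f_\omega(Z_1,\ldots,Z_\ell)=C\mathbf{A}_{i_1}(Z_1)\cdots\mathbf{A}_{i_{\ell-1}}(Z_{\ell-1})\mathbf{B}_{i_\ell}(Z_\ell)$$ for all $\omega=g_{i_1}\cdots g_{i_\ell}\neq\emptyset$ and $Z_1,\ldots,Z_\ell\in\mathbb{K}^{s\times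 s}$. Write $\mathbf{A}^\omega(Z_1,\ldots,Z_\ell)=\mathbf{A}_{i_1}(Z_1)\cdots\mathbf{A}_{i_\ell}(Z_\ell)$ ($=I_L$ for $\omega=\emptyset$) and suppose that the realization is controllable, i.e. the column spaces of all the matrices $\mathbf{A}^\omega(Z_1,\ldots,Z_{|\omega|})\mathbf{B}_k(Z_{|\omega|+1})$ together span $\mathbb{K}^L$, and observable, i.e. the intersection of the kernels of all the matrices $C\mathbf{A}^\omega(Z_1,\ldots,Z_{|\omega|})$ is $\{0\}$. Then $f$ is an nc function on $Nilp(\underline{Y})$, i.e. $Nilp(\underline{Y})$ is closed under direct sums, $f(\underline{X}\oplus\underline{X}')=f(\underline{X})\oplus f(\underline{X}')$ for all $\underline{X},\underline{X}'\in Nilp(\underline{Y})$, and $f(T\underline{X}T^{-1})=Tf(\underline{X})T^{-1}$ whenever $\underline{X}\in Nilp(\underline{Y})$ has size $n$, $T\in\mathbb{K}^{n\times n}$ is invertible and $T\underline{X}T^{-1}\in Nilp(\underline{Y})$, if and only if the following six equations (the linearized lost-abbey conditions) hold for all $S,Z_1,Z_2\in\mathbb{K}^{s\times s}$ and $1\le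 i_1,i_2\le d$, where $[S,Y_k]=SY_k-Y_kS$: $$SD-DS=C\sum_{k=1}^d\mathbf{B}_k([S,Y_k]),$$ $$SC\mathbf{B}_{i_1}(Z_1)-C\mathbf{B}_{i_1}(SZ_1)=C\Big(\sum_{k=1}^d\mathbf{A}_k([S,Y_k])\Big)\mathbf{B}_{i_1}(Z_1),$$ $$SC\mathbf{A}_{i_1}(Z_1)-C\mathbf{A}_{i_1}(SZ_1)=C\Big(\sum_{k=1}^d\mathbf{A}_k([S,Y_k])\Big)\mathbf{A}_{i_1}(Z_1),$$ $$\mathbf{B}_{i_1}(Z_1S)-\mathbf{B}_{i_1}(Z_1)S=\mathbf{A}_{i_1}(Z_1)\sum_{k=1}^d\mathbf{B}_k([S,Y_k]),$$ $$\mathbf{A}_{i_1}(Z_1S)\mathbf{B}_{i_2}(Z_2)-\mathbf{A}_{i_1}(Z_1)\mathbf{B}_{i_2}(SZ_2)=\mathbf{A}_{i_1}(Z_1)\Big(\sum_{k=1}^d\mathbf{A}_k([S,Y_k])\Big)\mathbf{B}_{i_2}(Z_2),$$ $$\mathbf{A}_{i_1}(Z_1S)\mathbf{A}_{i_2}(Z_2)-\mathbf{A}_{i_1}(Z_1)\mathbf{A}_{i_2}(SZ_2)=\mathbf{A}_{i_1}(Z_1)\Big(\sum_{k=1}^d\mathbf{A}_k([S,Y_k])\Big)\mathbf{A}_{i_2}(Z_2).$$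 -/

import Mathlib

open Matrix
open scoped BigOperators Kronecker

namespace NCReal

/-! ### Noncommutative sets and noncommutative functions over a field -/

/-- `X ⊕ Y`, the block diagonal matrix, again indexed by an initial segment of `ℕ`. -/
def directSum {K : Type*} [Field K] {n m : ℕ}
    (X : Matrix (Fin n) (Fin n) K) (Y : Matrix (Fin m) (Fin m) K) :
    Matrix (Fin (n + m)) (Fin (n + m)) K :=
  Matrix.reindex finSumFinEquiv finSumFinEquiv (Matrix.fromBlocks X 0 0 Y)

/-- A family `Ω n ⊆ (K^{n×n})^d`, for `n ≥ 1`, i.e. a subset of the nc space over `K^d`, is a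
nc set if it is closed under direct sums. -/
structure IsNCSet {K : Type*} [Field K] {d : ℕ}
    (Ω : (n : ℕ) → Set (Fin d → Matrix (Fin n) (Fin n) K)) : Prop where
  /-- only sizes `n ≥ 1` occur in the nc space -/
  pos : ∀ (n : ℕ) (X : Fin d → Matrix (Fin n) (Fin n) K), X ∈ Ω n → 0 < n
  directSum_mem : ∀ (n m : ℕ) (X : Fin d → Matrix (Fin n) (Fin n) K)
    (Y : Fin d → Matrix (Fin m) (Fin m) K), X ∈ Ω n → Y ∈ Ω m →
    (fun k => directSum (X k) (Y k)) ∈ Ω (n + m)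

/-- `f` is a nc function on the nc set `Ω`: it is graded (this is built into its type), and it
respects direct sums and similarities.  The values of `f` outside `Ω` play no role. -/
structure IsNCFunctionOn {K : Type*} [Field K] {d : ℕ}
    (Ω : (n : ℕ) → Set (Fin d → Matrix (Fin n) (Fin n) K))
    (f : (n : ℕ) → (Fin d → Matrix (Fin n) (Fin n) K) → Matrix (Fin n) (Fin n) K) : Prop where
  isNCSet : IsNCSet Ω
  map_directSum : ∀ (n m : ℕ) (X : Fin d → Matrix (Fin n) (Fin n) K)
    (Y : Fin d → Matrix (Fin m) (Fin m) K), X ∈ Ω n → Y ∈ Ω m →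
    f (n + m) (fun k => directSum (X k) (Y k)) = directSum (f n X) (f m Y)
  map_similarity : ∀ (n : ℕ) (X : Fin d → Matrix (Fin n) (Fin n) K)
    (T : (Matrix (Fin n) (Fin n) K)ˣ), X ∈ Ω n →
    (fun k => (T : Matrix (Fin n) (Fin n) K) * X k * (↑T⁻¹ : Matrix (Fin n) (Fin n) K)) ∈ Ω n →
    f n (fun k => (T : Matrix (Fin n) (Fin n) K) * X k * (↑T⁻¹ : Matrix (Fin n) (Fin n) K)) =
      (T : Matrix (Fin n) (Fin n) K) * f n X * (↑T⁻¹ : Matrix (Fin n) (Fin n) K)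

/-! ### Words, faux products and the nilpotent ball -/

/-- Words in `d` letters: a word of length `ℓ` is its sequence of letters `Fin ℓ → Fin d`. -/
abbrev Word (d : ℕ) : Type := (ℓ : ℕ) × (Fin ℓ → Fin d)

/-- The subdivision of `n` indices into `n / s` consecutive groups of `s` indices each:
the pair `(i, a)` corresponds to the index `a + s * i`. -/
def blockEquiv {s n : ℕ} (h : s ∣ n) : Fin (n / s) × Fin s ≃ Fin n :=
  finProdFinEquiv.trans (finCongr (Nat.div_mul_cancel h))

/-- An `n × n` matrix viewed as an `(n / s) × (n / s)` matrix of blocks of size `s × s`. -/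
def toBlocksOfDvd {K : Type*} {s n : ℕ} (h : s ∣ n) (X : Matrix (Fin n) (Fin n) K) :
    Matrix (Fin (n / s)) (Fin (n / s)) (Matrix (Fin s) (Fin s) K) :=
  (Matrix.comp (Fin (n / s)) (Fin (n / s)) (Fin s) (Fin s) K).symm
    (Matrix.reindex (blockEquiv h).symm (blockEquiv h).symm X)

/-- An `(n / s) × (n / s)` matrix of blocks of size `s × s` viewed as an `n × n` matrix. -/
def ofBlocksOfDvd {K : Type*} {s n : ℕ} (h : s ∣ n)
    (P : Matrix (Fin (n / s)) (Fin (n / s)) (Matrix (Fin s) (Fin s) K)) :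
    Matrix (Fin n) (Fin n) K :=
  Matrix.reindex (blockEquiv h) (blockEquiv h)
    (Matrix.comp (Fin (n / s)) (Fin (n / s)) (Fin s) (Fin s) K P)

/-- `I_m ⊗ Y` with `m = n / s`. -/
def amplify {K : Type*} [Field K] {s n : ℕ} (h : s ∣ n) (Y : Matrix (Fin s) (Fin s) K) :
    Matrix (Fin n) (Fin n) K :=
  Matrix.reindex (blockEquiv h) (blockEquiv h)
    ((1 : Matrix (Fin (n / s)) (Fin (n / s)) K) ⊗ₖ Y)

/-- `X^{⊙_s ω} = X_{i_1} ⊙_s ⋯ ⊙_s X_{i_ℓ}` for `ω = g_{i_1} ⋯ g_{i_ℓ}`, where the faux product is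
the product of block matrices over the tensor algebra of `K^{s×s}`. -/
noncomputable def fauxPow {K : Type*} [Field K] {s d m : ℕ}
    (X : Fin d → Matrix (Fin m) (Fin m) (Matrix (Fin s) (Fin s) K)) (ω : Word d) :
    Matrix (Fin m) (Fin m) (TensorAlgebra K (Matrix (Fin s) (Fin s) K)) :=
  (List.ofFn fun j : Fin ω.1 =>
    (X (ω.2 j)).map (TensorAlgebra.ι K : Matrix (Fin s) (Fin s) K →ₗ[K] _)).prod

/-- Joint nilpotency of a `d`-tuple of block matrices. -/
def JointlyNilpotent {K : Type*} [Field K] {s d m : ℕ}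
    (X : Fin d → Matrix (Fin m) (Fin m) (Matrix (Fin s) (Fin s) K)) : Prop :=
  ∃ κ : ℕ, ∀ ω : Word d, κ ≤ ω.1 → fauxPow X ω = 0

/-- The tuple `X - I_m ⊗ Y`, in block form. -/
def centered {K : Type*} [Field K] {s d n : ℕ} (Y : Fin d → Matrix (Fin s) (Fin s) K)
    (h : s ∣ n) (X : Fin d → Matrix (Fin n) (Fin n) K) :
    Fin d → Matrix (Fin (n / s)) (Fin (n / s)) (Matrix (Fin s) (Fin s) K) :=
  fun k => toBlocksOfDvd h (X k - amplify h (Y k))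

/-- The nilpotent ball around `Y`; it has points only in the sizes `n = s m`, `m ≥ 1`. -/
def Nilp {K : Type*} [Field K] {s d : ℕ} (Y : Fin d → Matrix (Fin s) (Fin s) K) (n : ℕ) :
    Set (Fin d → Matrix (Fin n) (Fin n) K) :=
  {X | 0 < n ∧ ∃ h : s ∣ n, JointlyNilpotent (centered Y h X)}

/-! ### Generalized nc power series -/

/-- The coefficients of a generalized nc power series around a `d`-tuple of `s × s` matrices:
for every word `ω` an `|ω|`-linear map from `(K^{s×s})^{|ω|}` to `K^{s×s}`. -/
abbrev GenPowerSeries (K : Type*) [Field K] (s d : ℕ) : Type _ :=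
  (ω : Word d) → MultilinearMap K (fun _ : Fin ω.1 => Matrix (Fin s) (Fin s) K)
    (Matrix (Fin s) (Fin s) K)

/-- The coefficient `f_ω` as a linear map on `(K^{s×s})^{⊗|ω|}`, the component of degree `|ω|` of
the tensor algebra (extended by `0` to the other components). -/
noncomputable def GenPowerSeries.coeffLin {K : Type*} [Field K] {s d : ℕ}
    (f : GenPowerSeries K s d) (ω : Word d) :
    TensorAlgebra K (Matrix (Fin s) (Fin s) K) →ₗ[K] Matrix (Fin s) (Fin s) K :=
  (PiTensorProduct.lift (f ω)).comp
    ((DirectSum.component K ℕ (fun ℓ => TensorPower K ℓ (Matrix (Fin s) (Fin s) K)) ω.1).comp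
      (TensorAlgebra.toDirectSum (R := K) (M := Matrix (Fin s) (Fin s) K)).toLinearMap)

/-- The sum `∑_ω (X - I_m ⊗ Y)^{⊙_s ω} f_ω`, with `f_ω` applied to the entries of the matrix
`(X - I_m ⊗ Y)^{⊙_s ω}`.  On the nilpotent ball around `Y` only finitely many terms are nonzero. -/
noncomputable def GenPowerSeries.eval {K : Type*} [Field K] {s d : ℕ}
    (f : GenPowerSeries K s d) (Y : Fin d → Matrix (Fin s) (Fin s) K)
    (n : ℕ) (X : Fin d → Matrix (Fin n) (Fin n) K) : Matrix (Fin n) (Fin n) K :=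
  open Classical in
  if h : s ∣ n then
    ofBlocksOfDvd h (∑ᶠ ω : Word d, (fauxPow (centered Y h X) ω).map (f.coeffLin ω))
  else 0

/-! ### Fornasini--Marchesini realizations -/

/-- The data `(L; D, C, A, B)` describing a nc Fornasini--Marchesini realization centred at a
`d`-tuple of `s × s` matrices. -/
structure FMRealization (K : Type*) [Field K] (s d L : ℕ) where
  D : Matrix (Fin s) (Fin s) K
  C : Matrix (Fin s) (Fin L) K
  A : Fin d → (Matrix (Fin s) (Fin s) K →ₗ[K] Matrix (Fin L) (Fin L) K)
  B : Fin d → (Matrix (Fin s) (Fin s) K →ₗ[K] Matrix (Fin L) (Fin s) K)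

namespace FMRealization

/-- `A^ω(Z_1, …, Z_ℓ) = A_{i_1}(Z_1) ⋯ A_{i_ℓ}(Z_ℓ)` for `ω = g_{i_1} ⋯ g_{i_ℓ}`. -/
def wordA {K : Type*} [Field K] {s d L : ℕ} (R : FMRealization K s d L) {ℓ : ℕ}
    (i : Fin ℓ → Fin d) (Z : Fin ℓ → Matrix (Fin s) (Fin s) K) : Matrix (Fin L) (Fin L) K :=
  (List.ofFn fun j : Fin ℓ => R.A (i j) (Z j)).prod

/-- `(A, B)` is controllable. -/
def Controllable {K : Type*} [Field K] {s d L : ℕ} (R : FMRealization K s d L) : Prop :=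
  (⨆ (ω : Word d) (Z : Fin ω.1 → Matrix (Fin s) (Fin s) K) (k : Fin d)
    (W : Matrix (Fin s) (Fin s) K),
      LinearMap.range (Matrix.mulVecLin (R.wordA ω.2 Z * R.B k W))) = ⊤

/-- `(C, A)` is observable. -/
def Observable {K : Type*} [Field K] {s d L : ℕ} (R : FMRealization K s d L) : Prop :=
  (⨅ (ω : Word d) (Z : Fin ω.1 → Matrix (Fin s) (Fin s) K),
      LinearMap.ker (Matrix.mulVecLin (R.C * R.wordA ω.2 Z))) = ⊥

/-- The linearized lost-abbey conditions. -/
structure LinearizedLostAbbey {K : Type*} [Field K] {s d L : ℕ} (R : FMRealization K s d L)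
    (Y : Fin d → Matrix (Fin s) (Fin s) K) : Prop where
  eq_D : ∀ S : Matrix (Fin s) (Fin s) K,
    S * R.D - R.D * S = R.C * ∑ k, R.B k (S * Y k - Y k * S)
  eq_CB : ∀ (S Z₁ : Matrix (Fin s) (Fin s) K) (i₁ : Fin d),
    S * R.C * R.B i₁ Z₁ - R.C * R.B i₁ (S * Z₁) =
      R.C * (∑ k, R.A k (S * Y k - Y k * S)) * R.B i₁ Z₁
  eq_CA : ∀ (S Z₁ : Matrix (Fin s) (Fin s) K) (i₁ : Fin d),
    S * R.C * R.A i₁ Z₁ - R.C * R.A i₁ (S * Z₁) =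
      R.C * (∑ k, R.A k (S * Y k - Y k * S)) * R.A i₁ Z₁
  eq_B : ∀ (S Z₁ : Matrix (Fin s) (Fin s) K) (i₁ : Fin d),
    R.B i₁ (Z₁ * S) - R.B i₁ Z₁ * S =
      R.A i₁ Z₁ * ∑ k, R.B k (S * Y k - Y k * S)
  eq_AB : ∀ (S Z₁ Z₂ : Matrix (Fin s) (Fin s) K) (i₁ i₂ : Fin d),
    R.A i₁ (Z₁ * S) * R.B i₂ Z₂ - R.A i₁ Z₁ * R.B i₂ (S * Z₂) =
      R.A i₁ Z₁ * (∑ k, R.A k (S * Y k - Y k * S)) * R.B i₂ Z₂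
  eq_AA : ∀ (S Z₁ Z₂ : Matrix (Fin s) (Fin s) K) (i₁ i₂ : Fin d),
    R.A i₁ (Z₁ * S) * R.A i₂ Z₂ - R.A i₁ Z₁ * R.A i₂ (S * Z₂) =
      R.A i₁ Z₁ * (∑ k, R.A k (S * Y k - Y k * S)) * R.A i₂ Z₂

end FMRealization

/-- The series with coefficients `f` admits the realization `R`: `f_∅ = D` and
`f_ω(Z_1, …, Z_ℓ) = C A_{i_1}(Z_1) ⋯ A_{i_{ℓ-1}}(Z_{ℓ-1}) B_{i_ℓ}(Z_ℓ)` for every word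
`ω = g_{i_1} ⋯ g_{i_ℓ}` of positive length. -/
def GenPowerSeries.Admits {K : Type*} [Field K] {s d L : ℕ}
    (f : GenPowerSeries K s d) (R : FMRealization K s d L) : Prop :=
  (∀ (i : Fin 0 → Fin d) (Z : Fin 0 → Matrix (Fin s) (Fin s) K), f ⟨0, i⟩ Z = R.D) ∧
  ∀ (ℓ : ℕ) (i : Fin (ℓ + 1) → Fin d) (Z : Fin (ℓ + 1) → Matrix (Fin s) (Fin s) K),
    f ⟨ℓ + 1, i⟩ Z =
      R.C * R.wordA (fun j : Fin ℓ => i j.castSucc) (fun j : Fin ℓ => Z j.castSucc) *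
        R.B (i (Fin.last ℓ)) (Z (Fin.last ℓ))

end NCReal

/-! On the nilpotent ball `f` is the transfer function F(W) = D + C(1 - A(W))⁻¹B(W), where W = X - I
⊗ Y and A, B act on the s × s blocks and are summed over the letters. Joint nilpotency makes A(W)
nilpotent, and the geometric series regroups the sum over words (`comp_finsum_coeffLin`,
`eval_submatrix`).

If X'T = TX, then W'T - TW = [T, I ⊗ Y]. A purely algebraic identity (`intertwining_identity`,
blockwise `blk_transfer_mul_sub`) then writes TF(W) - F(W')T as a sum of six kinds of terms. Each is
a defect, the difference of the two sides of one lost-abbey condition evaluated at blocks of T, W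
and W', multiplied by resolvent factors.

Sufficiency: when all defects vanish, `f` respects every intertwining, even by a rectangular T
(`eval_mul_eq`). Invertible T gives similarities, and the two coordinate inclusions give direct
sums.

Necessity uses similarities only. Take W strictly triangular, made of two disjoint chains of blocks,
and conjugate by a transvection whose single block S bridges the end of the first chain and the
start of the second. Defects vanish at S = 0 and S = 1, so only the bridge contributes, and a corner
block of the identity reads C A⋯A · defect · A⋯A B = 0, with outer factors missing for short chains
(`chain_identity`). Length 0 or positive for the first chain and length 0, 1 or at least 2 for the
second select the six defects. Observability and controllability remove the outer factors. -/

namespace NCReal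

/-! ### Block matrices indexed by product types -/

section Blocks

variable {K : Type*} {ι κ μ p q r : Type*}

/-- The block in position `(i, j)` of a matrix indexed by product types. -/
def blk (M : Matrix (ι × p) (κ × q) K) (i : ι) (j : κ) : Matrix p q K :=
  Matrix.of fun a b => M (i, a) (j, b)

theorem blk_ext {M N : Matrix (ι × p) (κ × q) K} (h : ∀ i j, blk M i j = blk N i j) : M = N := by
  ext ⟨i, a⟩ ⟨j, b⟩
  exact congrFun (congrFun (h i j) a) b

variable [Field K]

@[simp] theorem blk_add (M N : Matrix (ι × p) (κ × q) K) (i : ι) (j : κ) :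
    blk (M + N) i j = blk M i j + blk N i j := rfl

@[simp] theorem blk_sub (M N : Matrix (ι × p) (κ × q) K) (i : ι) (j : κ) :
    blk (M - N) i j = blk M i j - blk N i j := rfl

@[simp] theorem blk_zero (i : ι) (j : κ) : blk (0 : Matrix (ι × p) (κ × q) K) i j = 0 := rfl

@[simp] theorem blk_neg (M : Matrix (ι × p) (κ × q) K) (i : ι) (j : κ) :
    blk (-M) i j = -blk M i j := rfl

theorem blk_mul [Fintype κ] [Fintype q] (M : Matrix (ι × p) (κ × q) K)
    (N : Matrix (κ × q) (μ × r) K) (i : ι) (j : μ) :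
    blk (M * N) i j = ∑ k, blk M i k * blk N k j := by
  ext a b
  simp [blk, Matrix.mul_apply, Matrix.sum_apply, Fintype.sum_prod_type]

theorem blk_kronecker [DecidableEq ι] (M : Matrix p q K) (i j : ι) :
    blk ((1 : Matrix ι ι K) ⊗ₖ M) i j = if i = j then M else 0 := by
  ext a b
  by_cases h : i = j <;> simp [blk, h]

theorem blk_one [DecidableEq ι] [DecidableEq p] (i j : ι) :
    blk (1 : Matrix (ι × p) (ι × p) K) i j = if i = j then 1 else 0 := by
  ext a b
  by_cases h : i = j <;> simp [blk, Matrix.one_apply, h]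

theorem blk_kronecker_mul [Fintype ι] [DecidableEq ι] [Fintype q] (M : Matrix p q K)
    (N : Matrix (ι × q) (κ × r) K) (i : ι) (j : κ) :
    blk (((1 : Matrix ι ι K) ⊗ₖ M) * N) i j = M * blk N i j := by
  rw [blk_mul, Finset.sum_eq_single i]
  · rw [blk_kronecker, if_pos rfl]
  · intro k _ hk
    rw [blk_kronecker, if_neg (Ne.symm hk), Matrix.zero_mul]
  · simp

theorem blk_mul_kronecker [Fintype κ] [DecidableEq κ] [Fintype q] (M : Matrix q r K)
    (N : Matrix (ι × p) (κ × q) K) (i : ι) (j : κ) :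
    blk (N * ((1 : Matrix κ κ K) ⊗ₖ M)) i j = blk N i j * M := by
  rw [blk_mul, Finset.sum_eq_single j]
  · rw [blk_kronecker, if_pos rfl]
  · intro k _ hk
    rw [blk_kronecker, if_neg hk, Matrix.mul_zero]
  · simp

variable {d : ℕ}

/-- The blocks in position `(i, j)` of a tuple of matrices indexed by product types. -/
def tblk (W : Fin d → Matrix (ι × p) (κ × q) K) (i : ι) (j : κ) : Fin d → Matrix p q K :=
  fun k => blk (W k) i j

/-- Apply a linear map on tuples of matrices to each tuple of blocks. -/
def amp {p' q' : Type*} (φ : (Fin d → Matrix p q K) →ₗ[K] Matrix p' q' K)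
    (W : Fin d → Matrix (ι × p) (κ × q) K) : Matrix (ι × p') (κ × q') K :=
  Matrix.of fun x y => φ (tblk W x.1 y.1) x.2 y.2

@[simp] theorem blk_amp {p' q' : Type*} (φ : (Fin d → Matrix p q K) →ₗ[K] Matrix p' q' K)
    (W : Fin d → Matrix (ι × p) (κ × q) K) (i : ι) (j : κ) :
    blk (amp φ W) i j = φ (tblk W i j) := rfl

theorem amp_sub {p' q' : Type*} (φ : (Fin d → Matrix p q K) →ₗ[K] Matrix p' q' K)
    (W W' : Fin d → Matrix (ι × p) (κ × q) K) :
    amp φ (fun k => W k - W' k) = amp φ W - amp φ W' := by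
  refine blk_ext fun i j => ?_
  rw [blk_sub, blk_amp, blk_amp, blk_amp, ← map_sub]
  rfl

theorem tblk_mul_right [Fintype κ] [Fintype q] (W : Fin d → Matrix (ι × p) (κ × q) K)
    (T : Matrix (κ × q) (μ × r) K) (i : ι) (j : μ) :
    tblk (fun k => W k * T) i j = ∑ l, fun k => tblk W i l k * blk T l j := by
  funext k
  simp [tblk, blk_mul]

theorem tblk_mul_left [Fintype κ] [Fintype q] (T : Matrix (ι × p) (κ × q) K)
    (W : Fin d → Matrix (κ × q) (μ × r) K) (i : ι) (j : μ) :
    tblk (fun k => T * W k) i j = ∑ l, fun k => blk T i l * tblk W l j k := by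
  funext k
  simp [tblk, blk_mul]

end Blocks

/-! ### The transfer function of a realization and its intertwining defects -/

namespace FMRealization

section Defects

variable {K : Type*} [Field K] {s d L : ℕ} (R : FMRealization K s d L)

/-- `w ↦ ∑ A_k(w_k)` -/
def sumA : (Fin d → Matrix (Fin s) (Fin s) K) →ₗ[K] Matrix (Fin L) (Fin L) K :=
  ∑ k, (R.A k).comp (LinearMap.proj k)

/-- `w ↦ ∑ B_k(w_k)` -/
def sumB : (Fin d → Matrix (Fin s) (Fin s) K) →ₗ[K] Matrix (Fin L) (Fin s) K :=
  ∑ k, (R.B k).comp (LinearMap.proj k)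

theorem sumA_apply (w : Fin d → Matrix (Fin s) (Fin s) K) : R.sumA w = ∑ k, R.A k (w k) := by
  simp [sumA]

theorem sumB_apply (w : Fin d → Matrix (Fin s) (Fin s) K) : R.sumB w = ∑ k, R.B k (w k) := by
  simp [sumB]

theorem sumA_single (i : Fin d) (Z : Matrix (Fin s) (Fin s) K) :
    R.sumA (Pi.single i Z) = R.A i Z := by
  rw [sumA_apply, Finset.sum_eq_single i] <;> simp +contextual

theorem sumB_single (i : Fin d) (Z : Matrix (Fin s) (Fin s) K) :
    R.sumB (Pi.single i Z) = R.B i Z := by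
  rw [sumB_apply, Finset.sum_eq_single i] <;> simp +contextual

variable (Y : Fin d → Matrix (Fin s) (Fin s) K)

/-- Difference of the two sides of the first linearized lost-abbey condition. -/
def defectD (S : Matrix (Fin s) (Fin s) K) : Matrix (Fin s) (Fin s) K :=
  S * R.D - R.D * S - R.C * R.sumB fun k => S * Y k - Y k * S

/-- From here on the defects take whole tuples instead of a letter and a matrix, so that blocks of a
point can be inserted. By linearity, vanishing on tuples is the same as vanishing on tuples
supported at one letter. -/
def defectCB (S : Matrix (Fin s) (Fin s) K) (w : Fin d → Matrix (Fin s) (Fin s) K) :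
    Matrix (Fin s) (Fin s) K :=
  S * R.C * R.sumB w - R.C * R.sumB (fun k => S * w k) -
    R.C * (R.sumA fun k => S * Y k - Y k * S) * R.sumB w

def defectCA (S : Matrix (Fin s) (Fin s) K) (w : Fin d → Matrix (Fin s) (Fin s) K) :
    Matrix (Fin s) (Fin L) K :=
  S * R.C * R.sumA w - R.C * R.sumA (fun k => S * w k) -
    R.C * (R.sumA fun k => S * Y k - Y k * S) * R.sumA w

def defectB (w : Fin d → Matrix (Fin s) (Fin s) K) (S : Matrix (Fin s) (Fin s) K) :
    Matrix (Fin L) (Fin s) K :=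
  R.sumB (fun k => w k * S) - R.sumB w * S - R.sumA w * R.sumB fun k => S * Y k - Y k * S

def defectAB (w : Fin d → Matrix (Fin s) (Fin s) K) (S : Matrix (Fin s) (Fin s) K)
    (z : Fin d → Matrix (Fin s) (Fin s) K) : Matrix (Fin L) (Fin s) K :=
  R.sumA (fun k => w k * S) * R.sumB z - R.sumA w * R.sumB (fun k => S * z k) -
    R.sumA w * (R.sumA fun k => S * Y k - Y k * S) * R.sumB z

def defectAA (w : Fin d → Matrix (Fin s) (Fin s) K) (S : Matrix (Fin s) (Fin s) K)
    (z : Fin d → Matrix (Fin s) (Fin s) K) : Matrix (Fin L) (Fin L) K :=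
  R.sumA (fun k => w k * S) * R.sumA z - R.sumA w * R.sumA (fun k => S * z k) -
    R.sumA w * (R.sumA fun k => S * Y k - Y k * S) * R.sumA z

variable {ι κ : Type*} [Fintype ι] [Fintype κ] [DecidableEq ι] [DecidableEq κ]

/-- `D + C (I - A(W))⁻¹ B(W)`, amplified to block matrices indexed by `ι`. -/
noncomputable def transfer (W : Fin d → Matrix (ι × Fin s) (ι × Fin s) K) :
    Matrix (ι × Fin s) (ι × Fin s) K :=
  (1 : Matrix ι ι K) ⊗ₖ R.D +
    ((1 : Matrix ι ι K) ⊗ₖ R.C) * ((1 - amp R.sumA W)⁻¹ * amp R.sumB W)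

/-- The identity behind the intertwining of two transfer functions. -/
theorem intertwining_identity {m m' n n' : Type*} [Fintype m] [Fintype m'] [Fintype n] [Fintype n']
    [DecidableEq m] [DecidableEq m']
    (G a : Matrix m m K) (G' a' : Matrix m' m' K) (hG : (1 - a) * G = 1) (hG' : G' * (1 - a') = 1)
    (D : Matrix n n K) (D' : Matrix n' n' K) (C : Matrix n m K) (C' : Matrix n' m' K)
    (b : Matrix m n K) (b' : Matrix m' n' K) (T : Matrix n' n K)
    (p q : Matrix m' m K) (u v : Matrix m' n K) :
    (D' + C' * (G' * b')) * T - T * (D + C * (G * b)) =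
      -((T * D - D' * T - C' * (u - v)) +
        (T * C * b - C' * v - C' * (p - q) * b) +
        (T * C * a - C' * q - C' * (p - q) * a) * (G * b) +
        C' * G' * (u - b' * T - a' * (u - v)) +
        C' * G' * (p * b - a' * v - a' * (p - q) * b) +
        C' * G' * (p * a - a' * q - a' * (p - q) * a) * (G * b)) := by
  -- Only aG = G - 1 and G'a' = G' - 1 are needed. After these substitutions the six terms
  -- telescope.
  have h1 : ∀ x : Matrix m n K, a * (G * x) = G * x - x := fun x => by
    have := congrArg (· * x) hG
    simp only [Matrix.sub_mul, Matrix.one_mul, Matrix.mul_assoc] at this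
    exact eq_sub_iff_add_eq.2 (sub_eq_iff_eq_add'.1 this).symm
  have h2 : ∀ x : Matrix m' n K, G' * (a' * x) = G' * x - x := fun x => by
    have := congrArg (· * x) hG'
    simp only [Matrix.mul_sub, Matrix.sub_mul, Matrix.mul_one, Matrix.one_mul,
      Matrix.mul_assoc] at this
    exact eq_sub_iff_add_eq.2 (sub_eq_iff_eq_add'.1 this).symm
  simp only [Matrix.mul_add, Matrix.mul_sub, Matrix.add_mul, Matrix.sub_mul, Matrix.mul_assoc,
    h1, h2]
  abel

/-- The commutator `[T, I ⊗ Y]`. -/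
def commutator (T : Matrix (ι × Fin s) (κ × Fin s) K) :
    Fin d → Matrix (ι × Fin s) (κ × Fin s) K :=
  fun k => T * ((1 : Matrix κ κ K) ⊗ₖ Y k) - ((1 : Matrix ι ι K) ⊗ₖ Y k) * T

theorem tblk_commutator (T : Matrix (ι × Fin s) (κ × Fin s) K) (i : ι) (j : κ) :
    tblk (commutator Y T) i j = fun k => blk T i j * Y k - Y k * blk T i j := by
  funext k
  simp only [commutator, tblk, blk_sub, blk_mul_kronecker, blk_kronecker_mul]

theorem blk_defectD (T : Matrix (ι × Fin s) (κ × Fin s) K) (i : ι) (l : κ) :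
    blk (T * ((1 : Matrix κ κ K) ⊗ₖ R.D) - ((1 : Matrix ι ι K) ⊗ₖ R.D) * T -
      ((1 : Matrix ι ι K) ⊗ₖ R.C) * amp R.sumB (commutator Y T)) i l =
      R.defectD Y (blk T i l) := by
  simp only [blk_sub, blk_mul_kronecker, blk_kronecker_mul, blk_amp, tblk_commutator, defectD]

/-- `amp` acts block by block and is linear, so an expression in full matrices decomposes into the
same expression in blocks, summed over the inner indices. The same holds for the other defects. -/
theorem blk_defectCB (T : Matrix (ι × Fin s) (κ × Fin s) K)
    (W : Fin d → Matrix (κ × Fin s) (κ × Fin s) K) (i : ι) (l : κ) :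
    blk (T * ((1 : Matrix κ κ K) ⊗ₖ R.C) * amp R.sumB W -
      ((1 : Matrix ι ι K) ⊗ₖ R.C) * amp R.sumB (fun k => T * W k) -
      ((1 : Matrix ι ι K) ⊗ₖ R.C) * amp R.sumA (commutator Y T) * amp R.sumB W) i l =
      ∑ j, R.defectCB Y (blk T i j) (tblk W j l) := by
  rw [blk_sub, blk_sub, blk_mul, blk_mul _ (amp R.sumB W)]
  simp only [blk_mul_kronecker, blk_kronecker_mul, blk_amp, tblk_commutator, defectCB,
    tblk_mul_left, map_sum, Matrix.mul_sum, Finset.sum_sub_distrib]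

theorem blk_defectCA (T : Matrix (ι × Fin s) (κ × Fin s) K)
    (W : Fin d → Matrix (κ × Fin s) (κ × Fin s) K) (i : ι) (l : κ) :
    blk (T * ((1 : Matrix κ κ K) ⊗ₖ R.C) * amp R.sumA W -
      ((1 : Matrix ι ι K) ⊗ₖ R.C) * amp R.sumA (fun k => T * W k) -
      ((1 : Matrix ι ι K) ⊗ₖ R.C) * amp R.sumA (commutator Y T) * amp R.sumA W) i l =
      ∑ j, R.defectCA Y (blk T i j) (tblk W j l) := by
  rw [blk_sub, blk_sub, blk_mul, blk_mul _ (amp R.sumA W)]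
  simp only [blk_mul_kronecker, blk_kronecker_mul, blk_amp, tblk_commutator, defectCA,
    tblk_mul_left, map_sum, Matrix.mul_sum, Finset.sum_sub_distrib]

theorem blk_defectB (T : Matrix (ι × Fin s) (κ × Fin s) K)
    (W' : Fin d → Matrix (ι × Fin s) (ι × Fin s) K) (i : ι) (l : κ) :
    blk (amp R.sumB (fun k => W' k * T) - amp R.sumB W' * T -
      amp R.sumA W' * amp R.sumB (commutator Y T)) i l =
      ∑ k, R.defectB Y (tblk W' i k) (blk T k l) := by
  rw [blk_sub, blk_sub, blk_mul, blk_mul]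
  simp only [blk_amp, tblk_commutator, defectB, tblk_mul_right, map_sum, Finset.sum_sub_distrib]

theorem blk_defectAB (T : Matrix (ι × Fin s) (κ × Fin s) K)
    (W : Fin d → Matrix (κ × Fin s) (κ × Fin s) K)
    (W' : Fin d → Matrix (ι × Fin s) (ι × Fin s) K) (i : ι) (l : κ) :
    blk (amp R.sumA (fun k => W' k * T) * amp R.sumB W -
      amp R.sumA W' * amp R.sumB (fun k => T * W k) -
      amp R.sumA W' * amp R.sumA (commutator Y T) * amp R.sumB W) i l =
      ∑ k, ∑ j, R.defectAB Y (tblk W' i k) (blk T k j) (tblk W j l) := by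
  rw [blk_sub, blk_sub, blk_mul, blk_mul, blk_mul]
  simp only [blk_mul, blk_amp, tblk_commutator, defectAB, tblk_mul_right, tblk_mul_left, map_sum,
    Matrix.sum_mul, Matrix.mul_sum, Finset.sum_sub_distrib]
  rw [Finset.sum_comm]
  congr 1
  rw [Finset.sum_comm]

theorem blk_defectAA (T : Matrix (ι × Fin s) (κ × Fin s) K)
    (W : Fin d → Matrix (κ × Fin s) (κ × Fin s) K)
    (W' : Fin d → Matrix (ι × Fin s) (ι × Fin s) K) (i : ι) (l : κ) :
    blk (amp R.sumA (fun k => W' k * T) * amp R.sumA W -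
      amp R.sumA W' * amp R.sumA (fun k => T * W k) -
      amp R.sumA W' * amp R.sumA (commutator Y T) * amp R.sumA W) i l =
      ∑ k, ∑ j, R.defectAA Y (tblk W' i k) (blk T k j) (tblk W j l) := by
  rw [blk_sub, blk_sub, blk_mul, blk_mul, blk_mul]
  simp only [blk_mul, blk_amp, tblk_commutator, defectAA, tblk_mul_right, tblk_mul_left, map_sum,
    Matrix.sum_mul, Matrix.mul_sum, Finset.sum_sub_distrib]
  rw [Finset.sum_comm]
  congr 1
  rw [Finset.sum_comm]

/-- The blocks of `T F(W) - F(W') T` for intertwined points, in terms of the defects. -/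
theorem blk_transfer_mul_sub (W : Fin d → Matrix (κ × Fin s) (κ × Fin s) K)
    (W' : Fin d → Matrix (ι × Fin s) (ι × Fin s) K) (T : Matrix (ι × Fin s) (κ × Fin s) K)
    (hT : ∀ k, ((1 : Matrix ι ι K) ⊗ₖ Y k + W' k) * T = T * ((1 : Matrix κ κ K) ⊗ₖ Y k + W k))
    (hW : IsUnit (1 - amp R.sumA W)) (hW' : IsUnit (1 - amp R.sumA W')) (i : ι) (l : κ) :
    blk (R.transfer W' * T - T * R.transfer W) i l =
      -(R.defectD Y (blk T i l) +
        ∑ j, R.defectCB Y (blk T i j) (tblk W j l) +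
        ∑ m, (∑ j, R.defectCA Y (blk T i j) (tblk W j m)) *
          blk ((1 - amp R.sumA W)⁻¹ * amp R.sumB W) m l +
        ∑ n, blk (((1 : Matrix ι ι K) ⊗ₖ R.C) * (1 - amp R.sumA W')⁻¹) i n *
          ∑ k, R.defectB Y (tblk W' n k) (blk T k l) +
        ∑ n, blk (((1 : Matrix ι ι K) ⊗ₖ R.C) * (1 - amp R.sumA W')⁻¹) i n *
          ∑ k, ∑ j, R.defectAB Y (tblk W' n k) (blk T k j) (tblk W j l) +
        ∑ m, (∑ n, blk (((1 : Matrix ι ι K) ⊗ₖ R.C) * (1 - amp R.sumA W')⁻¹) i n *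
          ∑ k, ∑ j, R.defectAA Y (tblk W' n k) (blk T k j) (tblk W j m)) *
          blk ((1 - amp R.sumA W)⁻¹ * amp R.sumB W) m l) := by
  -- The intertwining hypothesis enters only here: it turns differences of amplified maps at W'T and
  -- TW into their values at the commutator.
  have hTk : commutator Y T = fun k => W' k * T - T * W k := by
    funext k
    have := hT k
    rw [Matrix.add_mul, Matrix.mul_add] at this
    rw [commutator, sub_eq_sub_iff_add_eq_add, ← this, add_comm]
  have hA := amp_sub R.sumA (fun k => W' k * T) (fun k => T * W k)
  have hB := amp_sub R.sumB (fun k => W' k * T) (fun k => T * W k)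
  rw [← hTk] at hA hB
  rw [transfer, transfer, intertwining_identity (1 - amp R.sumA W)⁻¹ (amp R.sumA W)
    (1 - amp R.sumA W')⁻¹ (amp R.sumA W')
    (Matrix.mul_nonsing_inv _ ((Matrix.isUnit_iff_isUnit_det _).1 hW))
    (Matrix.nonsing_inv_mul _ ((Matrix.isUnit_iff_isUnit_det _).1 hW'))
    _ _ _ _ _ _ T (amp R.sumA fun k => W' k * T) (amp R.sumA fun k => T * W k)
    (amp R.sumB fun k => W' k * T) (amp R.sumB fun k => T * W k), ← hA, ← hB]
  set ρ := ((1 : Matrix ι ι K) ⊗ₖ R.C) * (1 - amp R.sumA W')⁻¹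
  set c := (1 - amp R.sumA W)⁻¹ * amp R.sumB W
  rw [blk_neg, blk_add, blk_add, blk_add, blk_add, blk_add, blk_mul ρ, blk_mul ρ, blk_mul _ c,
    blk_mul _ c, blk_defectD]
  simp only [blk_mul ρ, blk_defectCB, blk_defectCA, blk_defectB, blk_defectAB, blk_defectAA]

end Defects
end FMRealization
end NCReal

namespace NCReal

/-! ### Multilinear maps on the tensor algebra -/

section TensorLin

variable {K V N : Type*} [Field K] [AddCommGroup V] [Module K V] [AddCommGroup N] [Module K N]

/-- An `ℓ`-linear map as a linear map on the tensor algebra, zero outside degree `ℓ`. -/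
noncomputable def tensorLin {ℓ : ℕ} (f : MultilinearMap K (fun _ : Fin ℓ => V) N) :
    TensorAlgebra K V →ₗ[K] N :=
  (PiTensorProduct.lift f).comp
    ((DirectSum.component K ℕ (fun ℓ => TensorPower K ℓ V) ℓ).comp
      (TensorAlgebra.toDirectSum (R := K) (M := V)).toLinearMap)

theorem tensorLin_tprod {ℓ : ℕ} (f : MultilinearMap K (fun _ : Fin ℓ => V) N) (x : Fin ℓ → V) :
    tensorLin f (TensorAlgebra.tprod K V ℓ x) = f x := by
  simp only [tensorLin, LinearMap.comp_apply, AlgHom.toLinearMap_apply,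
    TensorAlgebra.toDirectSum_tensorPower_tprod]
  rw [← DirectSum.lof_eq_of K, DirectSum.component.of, dif_pos rfl, PiTensorProduct.lift.tprod]

theorem tensorLin_tprod_of_ne {ℓ n : ℕ} (h : n ≠ ℓ)
    (f : MultilinearMap K (fun _ : Fin ℓ => V) N) (x : Fin n → V) :
    tensorLin f (TensorAlgebra.tprod K V n x) = 0 := by
  simp only [tensorLin, LinearMap.comp_apply, AlgHom.toLinearMap_apply,
    TensorAlgebra.toDirectSum_tensorPower_tprod]
  rw [← DirectSum.lof_eq_of K, DirectSum.component.of, dif_neg h, map_zero]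

theorem tensorAlgebra_hom_ext {φ ψ : TensorAlgebra K V →ₗ[K] N}
    (h : ∀ (n : ℕ) (x : Fin n → V),
      φ (TensorAlgebra.tprod K V n x) = ψ (TensorAlgebra.tprod K V n x)) : φ = ψ := by
  have hc : φ.comp (TensorAlgebra.ofDirectSum (R := K) (M := V)).toLinearMap =
      ψ.comp (TensorAlgebra.ofDirectSum (R := K) (M := V)).toLinearMap := by
    refine DirectSum.linearMap_ext K fun n => PiTensorProduct.ext ?_
    ext x
    simpa [DirectSum.lof_eq_of, TensorAlgebra.ofDirectSum_of_tprod] using h n x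
  ext1 t
  rw [← TensorAlgebra.ofDirectSum_toDirectSum t]
  exact LinearMap.congr_fun hc _

theorem tprod_mul_ι {n : ℕ} (x : Fin n → V) (z : V) :
    TensorAlgebra.tprod K V n x * TensorAlgebra.ι K z =
      TensorAlgebra.tprod K V (n + 1) (Fin.snoc x z : Fin (n + 1) → V) := by
  simp only [TensorAlgebra.tprod_apply]
  rw [List.ofFn_succ', List.prod_concat]
  simp

/-- This peels off the last tensor factor, which drives the inductions on word length. Pure tensors
suffice, and off degree `ℓ` both sides vanish. -/
theorem tensorLin_mul_ι {N' : Type*} [AddCommGroup N'] [Module K N'] {ℓ : ℕ}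
    (f : MultilinearMap K (fun _ : Fin (ℓ + 1) => V) N)
    (g : MultilinearMap K (fun _ : Fin ℓ => V) N') (z : V) (Φ : N' →ₗ[K] N)
    (h : ∀ x : Fin ℓ → V, f (Fin.snoc x z : Fin (ℓ + 1) → V) = Φ (g x)) (t : TensorAlgebra K V) :
    tensorLin f (t * TensorAlgebra.ι K z) = Φ (tensorLin g t) := by
  have : (tensorLin f).comp (LinearMap.mulRight K (TensorAlgebra.ι K z)) =
      Φ.comp (tensorLin g) := by
    refine tensorAlgebra_hom_ext fun n x => ?_
    simp only [LinearMap.comp_apply, LinearMap.mulRight_apply, tprod_mul_ι]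
    by_cases hn : n = ℓ
    · subst hn
      rw [tensorLin_tprod, tensorLin_tprod, h]
    · rw [tensorLin_tprod_of_ne (by omega), tensorLin_tprod_of_ne hn, map_zero]
  exact LinearMap.congr_fun this t

end TensorLin

/-! ### Evaluation of a realized power series -/

theorem fauxPow_succ {K : Type*} [Field K] {s d m : ℕ}
    (X : Fin d → Matrix (Fin m) (Fin m) (Matrix (Fin s) (Fin s) K)) {ℓ : ℕ}
    (i : Fin (ℓ + 1) → Fin d) :
    fauxPow X ⟨ℓ + 1, i⟩ = fauxPow X ⟨ℓ, fun j => i j.castSucc⟩ *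
      (X (i (Fin.last ℓ))).map
        (TensorAlgebra.ι K : Matrix (Fin s) (Fin s) K →ₗ[K] _) := by
  simp only [fauxPow]
  rw [List.ofFn_succ', List.prod_concat]

/-- The sum of all ordered products of length `ℓ` is the `ℓ`-th power of the sum. -/
theorem sum_word_prod {A : Type*} [Ring A] {d : ℕ} (M : Fin d → A) (ℓ : ℕ) :
    ∑ i : Fin ℓ → Fin d, (List.ofFn fun j => M (i j)).prod = (∑ k, M k) ^ ℓ := by
  have := (MultilinearMap.mkPiAlgebraFin ℤ ℓ A).map_sum fun (_ : Fin ℓ) k => M k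
  simpa using this.symm

/-- The matrix of blocks of a matrix indexed by product types. -/
def blocks {K : Type*} {ι p : Type*} (M : Matrix (ι × p) (ι × p) K) :
    Matrix ι ι (Matrix p p K) :=
  Matrix.of fun i j => blk M i j

namespace FMRealization

variable {K : Type*} [Field K] {s d L m : ℕ} (R : FMRealization K s d L)

/-- `wordA` as a multilinear map. -/
noncomputable def wordMultilinear {ℓ : ℕ} (i : Fin ℓ → Fin d) :
    MultilinearMap K (fun _ : Fin ℓ => Matrix (Fin s) (Fin s) K) (Matrix (Fin L) (Fin L) K) :=
  (MultilinearMap.mkPiAlgebraFin K ℓ (Matrix (Fin L) (Fin L) K)).compLinearMap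
    fun j => R.A (i j)

theorem wordMultilinear_apply {ℓ : ℕ} (i : Fin ℓ → Fin d)
    (Z : Fin ℓ → Matrix (Fin s) (Fin s) K) : R.wordMultilinear i Z = R.wordA i Z := by
  simp [wordMultilinear, wordA]

theorem wordA_succ {ℓ : ℕ} (i : Fin (ℓ + 1) → Fin d)
    (Z : Fin (ℓ + 1) → Matrix (Fin s) (Fin s) K) :
    R.wordA i Z = R.wordA (fun j : Fin ℓ => i j.castSucc) (fun j => Z j.castSucc) *
      R.A (i (Fin.last ℓ)) (Z (Fin.last ℓ)) := by
  simp only [wordA]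
  rw [List.ofFn_succ', List.prod_concat]

variable (W : Fin d → Matrix (Fin m × Fin s) (Fin m × Fin s) K)

/-- The summand of `amp R.sumA W` belonging to one letter. -/
def letterA (k : Fin d) : Matrix (Fin m × Fin L) (Fin m × Fin L) K :=
  amp ((R.A k).comp (LinearMap.proj k)) W

def letterB (k : Fin d) : Matrix (Fin m × Fin L) (Fin m × Fin s) K :=
  amp ((R.B k).comp (LinearMap.proj k)) W

theorem sum_letterA : ∑ k, R.letterA W k = amp R.sumA W := by
  ext x y
  simp [letterA, amp, sumA, Matrix.sum_apply]

theorem sum_letterB : ∑ k, R.letterB W k = amp R.sumB W := by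
  ext x y
  simp [letterB, amp, sumB, Matrix.sum_apply]

/-- Contracting with A^ω is multiplicative along the word, so it turns the faux product into an
ordinary product of block matrices. Hence vanishing of faux powers passes to products of the
amplified A's. -/
theorem tensorLin_word {ℓ : ℕ} (i : Fin ℓ → Fin d) (p q : Fin m) :
    tensorLin (R.wordMultilinear i) (fauxPow (fun k => blocks (W k)) ⟨ℓ, i⟩ p q) =
      blk (List.ofFn fun j => R.letterA W (i j)).prod p q := by
  induction ℓ generalizing p q with
  | zero =>
    have h1 : (1 : TensorAlgebra K (Matrix (Fin s) (Fin s) K)) =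
        TensorAlgebra.tprod K _ 0 (fun j => j.elim0) := by simp [TensorAlgebra.tprod_apply]
    by_cases h : p = q
    · subst h
      simp only [fauxPow, List.ofFn_zero, List.prod_nil, blk_one, Matrix.one_apply, if_true]
      rw [h1, tensorLin_tprod, wordMultilinear_apply]
      simp [wordA]
    · simp [fauxPow, blk_one, h]
  | succ ℓ ih =>
    rw [fauxPow_succ, List.ofFn_succ', List.prod_concat, blk_mul, Matrix.mul_apply, map_sum]
    refine Finset.sum_congr rfl fun r _ => ?_
    rw [← ih, Matrix.map_apply, tensorLin_mul_ι _ (R.wordMultilinear fun j => i j.castSucc) _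
      (LinearMap.mulRight K (R.A (i (Fin.last ℓ)) (blocks (W (i (Fin.last ℓ))) r q)))]
    · rfl
    · intro x
      rw [wordMultilinear_apply, wordMultilinear_apply, wordA_succ]
      simp

theorem tensorLin_admits {f : GenPowerSeries K s d} (hf : f.Admits R) {ℓ : ℕ}
    (i : Fin (ℓ + 1) → Fin d) (p q : Fin m) :
    tensorLin (f ⟨ℓ + 1, i⟩) (fauxPow (fun k => blocks (W k)) ⟨ℓ + 1, i⟩ p q) =
      R.C * blk ((List.ofFn fun j : Fin ℓ => R.letterA W (i j.castSucc)).prod *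
        R.letterB W (i (Fin.last ℓ))) p q := by
  rw [fauxPow_succ, blk_mul, Matrix.mul_apply, map_sum, Matrix.mul_sum]
  refine Finset.sum_congr rfl fun r _ => ?_
  rw [← tensorLin_word, Matrix.map_apply,
    tensorLin_mul_ι _ (R.wordMultilinear fun j => i j.castSucc) _
      ((mulLeftLinearMap (Fin s) K R.C).comp (mulRightLinearMap (Fin L) K
        (R.B (i (Fin.last ℓ)) (blocks (W (i (Fin.last ℓ))) r q))))]
  · rfl
  · intro x
    rw [wordMultilinear_apply, hf.2]
    simp [Matrix.mul_assoc]

/-- The `n`-th power expands into products over words of length `n`, each the image of a vanishing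
faux power. -/
theorem amp_sumA_pow_eq_zero {n : ℕ}
    (h : ∀ i : Fin n → Fin d, fauxPow (fun k => blocks (W k)) ⟨n, i⟩ = 0) :
    amp R.sumA W ^ n = 0 := by
  rw [← sum_letterA, ← sum_word_prod]
  refine Finset.sum_eq_zero fun i _ => blk_ext fun p q => ?_
  rw [← tensorLin_word, h, Matrix.zero_apply, map_zero, blk_zero]

theorem isUnit_one_sub_amp (h : JointlyNilpotent fun k => blocks (W k)) :
    IsUnit (1 - amp R.sumA W) := by
  obtain ⟨κ, hκ⟩ := h
  exact IsNilpotent.isUnit_one_sub ⟨κ, R.amp_sumA_pow_eq_zero W fun i => hκ ⟨κ, i⟩ le_rfl⟩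

theorem comp_finsum_coeffLin {f : GenPowerSeries K s d} (hf : f.Admits R)
    (h : JointlyNilpotent fun k => blocks (W k)) :
    Matrix.comp (Fin m) (Fin m) (Fin s) (Fin s) K
      (∑ᶠ ω : Word d, (fauxPow (fun k => blocks (W k)) ω).map (f.coeffLin ω)) =
      R.transfer W := by
  obtain ⟨κ, hκ⟩ := id h
  -- Lengths up to `κ` are kept although those of length `κ` contribute nothing: splitting off the
  -- empty word leaves lengths ℓ + 1 with ℓ < `κ`, matching the terms A(W)^ℓ B(W) of the geometric
  -- sum.
  rw [finsum_eq_sum_of_support_subset (s := (Finset.range (κ + 1)).sigma fun _ => Finset.univ),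
    Finset.sum_sigma, Finset.sum_range_succ']
  · have hinv : (1 - amp R.sumA W)⁻¹ = ∑ ℓ ∈ Finset.range κ, amp R.sumA W ^ ℓ := by
      refine Matrix.inv_eq_right_inv ?_
      rw [mul_neg_geom_sum, R.amp_sumA_pow_eq_zero W fun i => hκ ⟨κ, i⟩ le_rfl, sub_zero]
    refine blk_ext fun p q => ?_
    rw [transfer, hinv, add_comm, blk_add, blk_kronecker, blk_kronecker_mul, Matrix.sum_mul,
      ← sum_letterB]
    have h0 (M : Matrix (Fin m) (Fin m) (Matrix (Fin s) (Fin s) K)) :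
        blk (Matrix.comp (Fin m) (Fin m) (Fin s) (Fin s) K M) p q = M p q := rfl
    rw [h0, Matrix.add_apply, Matrix.sum_apply]
    congr 1
    · rw [Fintype.sum_eq_single (fun j : Fin 0 => j.elim0) fun x hx =>
        absurd (Subsingleton.elim _ _) hx]
      have h1 : (1 : TensorAlgebra K (Matrix (Fin s) (Fin s) K)) =
        TensorAlgebra.tprod K _ 0 (fun j => j.elim0) := by simp [TensorAlgebra.tprod_apply]
      by_cases hpq : p = q
      · subst hpq
        simp only [fauxPow, List.ofFn_zero, List.prod_nil, Matrix.map_apply, Matrix.one_apply,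
          if_true]
        rw [h1]
        exact (tensorLin_tprod _ _).trans (hf.1 _ _)
      · simp [fauxPow, hpq]
    · have hblk {α : Type} (S : Finset α) (M : α → Matrix (Fin m × Fin L) (Fin m × Fin s) K) :
          R.C * blk (∑ x ∈ S, M x) p q = ∑ x ∈ S, R.C * blk (M x) p q := by
        rw [← Matrix.mul_sum]
        congr 1
        ext a b
        simp [blk, Matrix.sum_apply]
      rw [hblk, Matrix.sum_apply]
      refine Finset.sum_congr rfl fun ℓ _ => ?_
      -- A word of length ℓ + 1 is a word of length ℓ, feeding the A's, followed by one letter,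
      -- feeding B.
      rw [← sum_letterA, ← sum_word_prod, Matrix.sum_mul, hblk, Matrix.sum_apply,
        ← (Fin.snocEquiv fun _ : Fin (ℓ + 1) => Fin d).sum_comp, Fintype.sum_prod_type_right]
      refine Finset.sum_congr rfl fun i _ => ?_
      rw [Matrix.mul_sum, hblk]
      refine Finset.sum_congr rfl fun k _ => ?_
      refine (R.tensorLin_admits W hf _ p q).trans ?_
      simp [Fin.snocEquiv]
  · intro ω hω
    simp only [Finset.coe_sigma, Set.mem_sigma_iff, Finset.coe_range, Set.mem_Iio,
      Finset.coe_univ, Set.mem_univ, and_true]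
    by_contra hlt
    exact hω (by dsimp only; rw [hκ ω (by omega)]; ext; simp)

end FMRealization
end NCReal

namespace NCReal

/-! ### Points of the nilpotent ball -/

section Points

variable {K : Type*} [Field K] {s d n : ℕ}

/-- `X - I_m ⊗ Y`, indexed by pairs of a block index and an index within the block. -/
def shifted (Y : Fin d → Matrix (Fin s) (Fin s) K) (h : s ∣ n)
    (X : Fin d → Matrix (Fin n) (Fin n) K) :
    Fin d → Matrix (Fin (n / s) × Fin s) (Fin (n / s) × Fin s) K :=
  fun k => (X k).submatrix (blockEquiv h) (blockEquiv h) - (1 : Matrix _ _ K) ⊗ₖ Y k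

theorem centered_eq_blocks (Y : Fin d → Matrix (Fin s) (Fin s) K) (h : s ∣ n)
    (X : Fin d → Matrix (Fin n) (Fin n) K) :
    centered Y h X = fun k => blocks (shifted Y h X k) := by
  funext k
  ext i j a b
  simp [centered, toBlocksOfDvd, amplify, blocks, shifted, blk]

theorem eval_submatrix {L : ℕ} {Y : Fin d → Matrix (Fin s) (Fin s) K} {f : GenPowerSeries K s d}
    {R : FMRealization K s d L} (hf : f.Admits R) (h : s ∣ n)
    {X : Fin d → Matrix (Fin n) (Fin n) K} (hX : JointlyNilpotent (centered Y h X)) :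
    (f.eval Y n X).submatrix (blockEquiv h) (blockEquiv h) = R.transfer (shifted Y h X) := by
  rw [centered_eq_blocks] at hX
  rw [← R.comp_finsum_coeffLin _ hf hX, GenPowerSeries.eval, dif_pos h, centered_eq_blocks,
    ofBlocksOfDvd]
  simp [Matrix.submatrix_submatrix]

end Points

/-! ### Sufficiency of the lost-abbey conditions -/

namespace FMRealization

variable {K : Type*} [Field K] {s d L : ℕ} {R : FMRealization K s d L}
  {Y : Fin d → Matrix (Fin s) (Fin s) K}

section Vanishing

variable (hR : R.LinearizedLostAbbey Y) (S : Matrix (Fin s) (Fin s) K)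
  (w z : Fin d → Matrix (Fin s) (Fin s) K)
include hR

theorem LinearizedLostAbbey.defectD_eq_zero : R.defectD Y S = 0 := by
  rw [defectD, hR.eq_D, sumB_apply, sub_self]

theorem LinearizedLostAbbey.defectCB_eq_zero : R.defectCB Y S w = 0 := by
  rw [defectCB, sub_eq_zero]
  simp only [sumB_apply R w, sumB_apply R fun k => S * w k, sumA_apply, Matrix.mul_sum,
    ← Finset.sum_sub_distrib, hR.eq_CB]

theorem LinearizedLostAbbey.defectCA_eq_zero : R.defectCA Y S w = 0 := by
  rw [defectCA, sub_eq_zero]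
  simp only [sumA_apply R w, sumA_apply R fun k => S * w k, Matrix.mul_sum,
    ← Finset.sum_sub_distrib, hR.eq_CA, ← sumA_apply R fun k => S * Y k - Y k * S]

theorem LinearizedLostAbbey.defectB_eq_zero : R.defectB Y w S = 0 := by
  rw [defectB, sub_eq_zero]
  simp only [sumB_apply, sumA_apply, Matrix.sum_mul, ← Finset.sum_sub_distrib, hR.eq_B]

theorem LinearizedLostAbbey.defectAB_eq_zero : R.defectAB Y w S z = 0 := by
  have key (i j) : R.A i (w i * S) * R.B j (z j) - R.A i (w i) * R.B j (S * z j) =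
      R.A i (w i) * (R.sumA fun k => S * Y k - Y k * S) * R.B j (z j) := by
    rw [hR.eq_AB, sumA_apply]
  rw [defectAB, sub_eq_zero]
  -- Naming the commutator term keeps it whole while the outer factors are expanded over letters.
  generalize (R.sumA fun k => S * Y k - Y k * S) = g at key ⊢
  simp only [sumA_apply, sumB_apply, Matrix.mul_sum, Matrix.sum_mul, ← Finset.sum_sub_distrib, key]

theorem LinearizedLostAbbey.defectAA_eq_zero : R.defectAA Y w S z = 0 := by
  have key (i j) : R.A i (w i * S) * R.A j (z j) - R.A i (w i) * R.A j (S * z j) =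
      R.A i (w i) * (R.sumA fun k => S * Y k - Y k * S) * R.A j (z j) := by
    rw [hR.eq_AA, sumA_apply]
  rw [defectAA, sub_eq_zero]
  generalize (R.sumA fun k => S * Y k - Y k * S) = g at key ⊢
  simp only [sumA_apply, Matrix.mul_sum, Matrix.sum_mul, ← Finset.sum_sub_distrib, key]

end Vanishing

/-- A realized series satisfying the lost-abbey conditions respects all intertwinings. -/
theorem LinearizedLostAbbey.eval_mul_eq {f : GenPowerSeries K s d} (hf : f.Admits R)
    (hR : R.LinearizedLostAbbey Y) {n n' : ℕ} {X : Fin d → Matrix (Fin n) (Fin n) K}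
    {X' : Fin d → Matrix (Fin n') (Fin n') K} (hX : X ∈ Nilp Y n) (hX' : X' ∈ Nilp Y n')
    (T : Matrix (Fin n') (Fin n) K) (hT : ∀ k, X' k * T = T * X k) :
    f.eval Y n' X' * T = T * f.eval Y n X := by
  obtain ⟨-, h, hX⟩ := hX
  obtain ⟨-, h', hX'⟩ := hX'
  have e := eval_submatrix hf h hX
  have e' := eval_submatrix hf h' hX'
  rw [centered_eq_blocks] at hX hX'
  have hT' : R.transfer (shifted Y h' X') * T.submatrix (blockEquiv h') (blockEquiv h) =
      T.submatrix (blockEquiv h') (blockEquiv h) * R.transfer (shifted Y h X) := by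
    rw [← sub_eq_zero]
    refine blk_ext fun i l => ?_
    rw [blk_transfer_mul_sub R Y (shifted Y h X) (shifted Y h' X') _ ?_
      (R.isUnit_one_sub_amp _ hX) (R.isUnit_one_sub_amp _ hX')]
    · simp [hR.defectD_eq_zero, hR.defectCB_eq_zero, hR.defectCA_eq_zero, hR.defectB_eq_zero,
        hR.defectAB_eq_zero, hR.defectAA_eq_zero]
    · intro k
      simp only [shifted, add_sub_cancel]
      rw [Matrix.submatrix_mul_equiv, Matrix.submatrix_mul_equiv, hT]
  rw [← e, ← e', Matrix.submatrix_mul_equiv, Matrix.submatrix_mul_equiv] at hT'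
  ext i j
  simpa using congrFun (congrFun hT' ((blockEquiv h').symm i)) ((blockEquiv h).symm j)

end FMRealization

/-! ### The nilpotent ball is closed under direct sums -/

section DirectSum

variable {K : Type*} [Field K] {s d : ℕ}

theorem castAdd_ne_natAdd {n m : ℕ} (i : Fin n) (j : Fin m) :
    Fin.castAdd m i ≠ Fin.natAdd n j := fun h => by
  have := congrArg Fin.val h
  simp only [Fin.val_castAdd, Fin.val_natAdd] at this
  omega

theorem directSum_mul_inl {n m : ℕ} (X : Matrix (Fin n) (Fin n) K) (Y : Matrix (Fin m) (Fin m) K) :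
    directSum X Y * (1 : Matrix (Fin (n + m)) (Fin (n + m)) K).submatrix id (Fin.castAdd m) =
      (1 : Matrix (Fin (n + m)) (Fin (n + m)) K).submatrix id (Fin.castAdd m) * X := by
  ext i j
  refine Fin.addCases (fun i => ?_) (fun i => ?_) i <;>
    simp [Matrix.mul_apply, Matrix.one_apply, directSum, (castAdd_ne_natAdd _ _).symm]

theorem directSum_mul_inr {n m : ℕ} (X : Matrix (Fin n) (Fin n) K) (Y : Matrix (Fin m) (Fin m) K) :
    directSum X Y * (1 : Matrix (Fin (n + m)) (Fin (n + m)) K).submatrix id (Fin.natAdd n) =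
      (1 : Matrix (Fin (n + m)) (Fin (n + m)) K).submatrix id (Fin.natAdd n) * Y := by
  ext i j
  refine Fin.addCases (fun i => ?_) (fun i => ?_) i <;>
    simp [Matrix.mul_apply, Matrix.one_apply, directSum, castAdd_ne_natAdd]

/-- The two coordinate inclusions together reach every column, so intertwining with both determines
the matrix. This is how direct sums reduce to intertwinings. -/
theorem eq_directSum {n m : ℕ} {M : Matrix (Fin (n + m)) (Fin (n + m)) K}
    {X : Matrix (Fin n) (Fin n) K} {Y : Matrix (Fin m) (Fin m) K}
    (h₁ : M * (1 : Matrix (Fin (n + m)) (Fin (n + m)) K).submatrix id (Fin.castAdd m) =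
      (1 : Matrix (Fin (n + m)) (Fin (n + m)) K).submatrix id (Fin.castAdd m) * X)
    (h₂ : M * (1 : Matrix (Fin (n + m)) (Fin (n + m)) K).submatrix id (Fin.natAdd n) =
      (1 : Matrix (Fin (n + m)) (Fin (n + m)) K).submatrix id (Fin.natAdd n) * Y) :
    M = directSum X Y := by
  rw [← directSum_mul_inl X Y] at h₁
  rw [← directSum_mul_inr X Y] at h₂
  ext i j
  refine Fin.addCases (fun j => ?_) (fun j => ?_) j
  · simpa [Matrix.mul_apply, Matrix.one_apply] using congrFun (congrFun h₁ i) j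
  · simpa [Matrix.mul_apply, Matrix.one_apply] using congrFun (congrFun h₂ i) j

theorem list_prod_intertwining {A ι κ : Type*} [Ring A] [Fintype ι] [Fintype κ] [DecidableEq ι]
    [DecidableEq κ] (J : Matrix ι κ A) {ℓ : ℕ} (M : Fin ℓ → Matrix κ κ A)
    (M' : Fin ℓ → Matrix ι ι A) (h : ∀ j, M' j * J = J * M j) :
    (List.ofFn M').prod * J = J * (List.ofFn M).prod := by
  induction ℓ with
  | zero => simp
  | succ ℓ ih =>
    rw [List.ofFn_succ, List.ofFn_succ, List.prod_cons, List.prod_cons, Matrix.mul_assoc,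
      ih _ _ fun j => h j.succ, ← Matrix.mul_assoc, h, Matrix.mul_assoc]

/-- Columns of faux products of block matrices that restrict to an invariant set of indices. -/
theorem fauxPow_apply_eq_zero {m m' : ℕ}
    {X : Fin d → Matrix (Fin m) (Fin m) (Matrix (Fin s) (Fin s) K)}
    {X' : Fin d → Matrix (Fin m') (Fin m') (Matrix (Fin s) (Fin s) K)}
    (e : Fin m → Fin m') (he : Function.Injective e)
    (h₁ : ∀ k i j, X' k (e i) (e j) = X k i j)
    (h₂ : ∀ k i j, (∀ i₀, e i₀ ≠ i) → X' k i (e j) = 0)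
    {ω : Word d} (hω : fauxPow X ω = 0) (i : Fin m') (j : Fin m) : fauxPow X' ω i (e j) = 0 := by
  -- `J` is the inclusion of the index set along `e`. The hypotheses on blocks say X'J = JX, which
  -- passes to products.
  let J : Matrix (Fin m') (Fin m) (TensorAlgebra K (Matrix (Fin s) (Fin s) K)) :=
    (1 : Matrix (Fin m') (Fin m') _).submatrix id e
  have := list_prod_intertwining J
    (fun j => (X (ω.2 j)).map (TensorAlgebra.ι K : Matrix (Fin s) (Fin s) K →ₗ[K] _))
    (fun j => (X' (ω.2 j)).map (TensorAlgebra.ι K : Matrix (Fin s) (Fin s) K →ₗ[K] _)) (by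
      intro l
      ext i j
      simp only [J, Matrix.mul_apply, Matrix.map_apply, Matrix.submatrix_apply, id,
        Matrix.one_apply, mul_ite, mul_one, mul_zero, ite_mul, one_mul, zero_mul,
        Finset.sum_ite_eq', Finset.mem_univ, if_true]
      by_cases hi : ∃ i₀, e i₀ = i
      · obtain ⟨i₀, rfl⟩ := hi
        simp [he.eq_iff, h₁]
      · push Not at hi
        rw [h₂ _ _ _ hi, map_zero, Finset.sum_eq_zero]
        intro x _
        rw [if_neg (hi x).symm])
  have hJ := congrFun (congrFun this i) j
  change (fauxPow X' ω * J) i j = (J * fauxPow X ω) i j at hJ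
  simpa [hω, J, Matrix.mul_apply, Matrix.one_apply] using hJ

theorem Nilp.directSum_mem {Y : Fin d → Matrix (Fin s) (Fin s) K} {n m : ℕ}
    {X : Fin d → Matrix (Fin n) (Fin n) K} {X' : Fin d → Matrix (Fin m) (Fin m) K}
    (hX : X ∈ Nilp Y n) (hX' : X' ∈ Nilp Y m) :
    (fun k => directSum (X k) (X' k)) ∈ Nilp Y (n + m) := by
  obtain ⟨hn, h, κ, hκ⟩ := hX
  obtain ⟨hm, h', κ', hκ'⟩ := hX'
  have hadd : (n + m) / s = n / s + m / s := Nat.add_div_of_dvd_right h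
  let e₁ : Fin (n / s) → Fin ((n + m) / s) := fun i => Fin.cast hadd.symm (Fin.castAdd _ i)
  let e₂ : Fin (m / s) → Fin ((n + m) / s) := fun i => Fin.cast hadd.symm (Fin.natAdd _ i)
  have b₁ (i a) : blockEquiv (dvd_add h h') (e₁ i, a) = Fin.castAdd m (blockEquiv h (i, a)) := by
    ext; simp [blockEquiv, e₁]
  have b₂ (i a) : blockEquiv (dvd_add h h') (e₂ i, a) = Fin.natAdd n (blockEquiv h' (i, a)) := by
    ext
    simp only [blockEquiv, e₂, Equiv.trans_apply, finCongr_apply, Fin.val_cast,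
      finProdFinEquiv_apply_val, Fin.val_natAdd, Nat.mul_add, Nat.mul_div_cancel' h]
    omega
  have i₁ : Function.Injective e₁ := fun i j hij => by simpa [e₁] using hij
  have i₂ : Function.Injective e₂ := fun i j hij => by simpa [e₂] using hij
  have hne (i j) : e₁ i ≠ e₂ j := fun hij => by
    have := congrArg Fin.val hij
    simp only [e₁, e₂, Fin.val_cast, Fin.val_castAdd, Fin.val_natAdd] at this
    omega
  have hcov (i) : (∃ i₀, e₁ i₀ = i) ∨ ∃ i₀, e₂ i₀ = i := by
    by_cases hi : i.val < n / s
    · exact .inl ⟨⟨i, hi⟩, by ext; simp [e₁]⟩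
    · exact .inr ⟨⟨i - n / s, by omega⟩, by ext; simp [e₂]; omega⟩
  refine ⟨by omega, dvd_add h h', max κ κ', fun ω hω => ?_⟩
  rw [centered_eq_blocks] at hκ hκ' ⊢
  ext i j
  rw [Matrix.zero_apply]
  -- Each block column belongs to one summand, whose block indices form an invariant set, so its
  -- faux powers vanish with those of that summand.
  obtain ⟨j, rfl⟩ | ⟨j, rfl⟩ := hcov j
  · refine fauxPow_apply_eq_zero e₁ i₁ ?_ ?_ (hκ ω (by omega)) i j
    · intro k i j
      ext a b
      simp [blocks, blk, shifted, b₁, directSum, Matrix.one_apply, i₁.eq_iff]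
    · intro k i j hi
      obtain ⟨i, rfl⟩ := (hcov i).resolve_left (by simpa using hi)
      ext a b
      simp [blocks, blk, shifted, b₁, b₂, directSum, Matrix.one_apply, (hne _ _).symm]
  · refine fauxPow_apply_eq_zero e₂ i₂ ?_ ?_ (hκ' ω (by omega)) i j
    · intro k i j
      ext a b
      simp [blocks, blk, shifted, b₂, directSum, Matrix.one_apply, i₂.eq_iff]
    · intro k i j hi
      obtain ⟨i, rfl⟩ := (hcov i).resolve_right (by simpa using hi)
      ext a b
      simp [blocks, blk, shifted, b₁, b₂, directSum, Matrix.one_apply, hne]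

end DirectSum

theorem FMRealization.LinearizedLostAbbey.isNCFunctionOn {K : Type*} [Field K] {s d L : ℕ}
    {R : FMRealization K s d L} {Y : Fin d → Matrix (Fin s) (Fin s) K}
    {f : GenPowerSeries K s d} (hf : f.Admits R)
    (hR : R.LinearizedLostAbbey Y) : IsNCFunctionOn (Nilp Y) (f.eval Y) where
  isNCSet := ⟨fun _ _ hX => hX.1, fun _ _ _ _ hX hX' => Nilp.directSum_mem hX hX'⟩
  map_directSum n m X X' hX hX' := by
    have hS := Nilp.directSum_mem hX hX'
    exact eq_directSum
      (hR.eval_mul_eq hf hX hS _ fun k => directSum_mul_inl (X k) (X' k))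
      (hR.eval_mul_eq hf hX' hS _ fun k => directSum_mul_inr (X k) (X' k))
  map_similarity n X T hX hTX := by
    rw [← hR.eval_mul_eq hf hX hTX T fun k => by simp [Matrix.mul_assoc], Matrix.mul_assoc,
      Units.mul_inv, Matrix.mul_one]

end NCReal

namespace NCReal

/-! ### Triangular points of the nilpotent ball -/

/-- Every factor strictly raises the rank, so a word of length ℓ raises it by at least ℓ, while
ranks on a finite set are bounded. -/
theorem jointlyNilpotent_of_rank {K : Type*} [Field K] {s d m : ℕ}
    {X : Fin d → Matrix (Fin m) (Fin m) (Matrix (Fin s) (Fin s) K)} (r : Fin m → ℕ)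
    (h : ∀ k i j, r j ≤ r i → X k i j = 0) : JointlyNilpotent X := by
  have key : ∀ (ℓ : ℕ) (i : Fin ℓ → Fin d) (p q), r q < r p + ℓ → fauxPow X ⟨ℓ, i⟩ p q = 0 := by
    intro ℓ
    induction ℓ with
    | zero =>
      intro i p q hpq
      have : p ≠ q := by rintro rfl; omega
      simp [fauxPow, this]
    | succ ℓ ih =>
      intro i p q hpq
      rw [fauxPow_succ, Matrix.mul_apply]
      refine Finset.sum_eq_zero fun t _ => ?_
      by_cases ht : r t < r p + ℓ
      · rw [ih _ _ _ ht, zero_mul]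
      · rw [Matrix.map_apply, h _ _ _ (by omega), map_zero, mul_zero]
  refine ⟨Finset.univ.sup r + 1, fun ⟨ℓ, i⟩ hω => ?_⟩
  ext p q
  refine key ℓ i p q ?_
  have := Finset.le_sup (f := r) (Finset.mem_univ q)
  dsimp only at hω
  omega

/-! ### Strictly triangular tuples and their transport to points of the nilpotent ball. -/

section Triangular

variable {K : Type*} [Field K] {s d L : ℕ} {ι ι' : Type*}

/-- The tuples of block matrices that are strictly triangular with respect to the rank `r`. -/
def StrictlyRanked (r : ι → ℕ) (W : Fin d → Matrix (ι × Fin s) (ι × Fin s) K) : Prop :=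
  ∀ k i j, r j ≤ r i → blk (W k) i j = 0

theorem amp_reindex {p q : Type*} (φ : (Fin d → Matrix (Fin s) (Fin s) K) →ₗ[K] Matrix p q K)
    (W : Fin d → Matrix (ι × Fin s) (ι × Fin s) K) (g : ι' ≃ ι) :
    amp φ (fun k => (W k).submatrix (g.prodCongr (Equiv.refl (Fin s)))
      (g.prodCongr (Equiv.refl (Fin s)))) =
      (amp φ W).submatrix (g.prodCongr (Equiv.refl p)) (g.prodCongr (Equiv.refl q)) := rfl

variable [DecidableEq ι] [DecidableEq ι']

theorem one_sub_amp_reindex {p : Type*} [DecidableEq p]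
    (φ : (Fin d → Matrix (Fin s) (Fin s) K) →ₗ[K] Matrix p p K)
    (W : Fin d → Matrix (ι × Fin s) (ι × Fin s) K) (g : ι' ≃ ι) :
    1 - amp φ (fun k => (W k).submatrix (g.prodCongr (Equiv.refl (Fin s)))
      (g.prodCongr (Equiv.refl (Fin s)))) =
      (1 - amp φ W).submatrix (g.prodCongr (Equiv.refl p)) (g.prodCongr (Equiv.refl p)) := by
  rw [amp_reindex, ← Matrix.submatrix_one_equiv (g.prodCongr (Equiv.refl p))]
  rfl

theorem kronecker_reindex {p q : Type*} (M : Matrix p q K) (g : ι' ≃ ι) :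
    ((1 : Matrix ι ι K) ⊗ₖ M).submatrix (g.prodCongr (Equiv.refl p))
      (g.prodCongr (Equiv.refl q)) = (1 : Matrix ι' ι' K) ⊗ₖ M := by
  ext ⟨i, a⟩ ⟨j, b⟩
  simp [Matrix.one_apply]

theorem FMRealization.transfer_reindex [Fintype ι] [Fintype ι'] (R : FMRealization K s d L)
    (W : Fin d → Matrix (ι × Fin s) (ι × Fin s) K) (g : ι' ≃ ι) :
    R.transfer (fun k => (W k).submatrix (g.prodCongr (Equiv.refl (Fin s)))
      (g.prodCongr (Equiv.refl (Fin s)))) =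
      (R.transfer W).submatrix (g.prodCongr (Equiv.refl (Fin s)))
        (g.prodCongr (Equiv.refl (Fin s))) := by
  rw [transfer, transfer, one_sub_amp_reindex, amp_reindex,
    Matrix.inv_submatrix_equiv, Matrix.submatrix_mul_equiv, ← kronecker_reindex R.C g,
    Matrix.submatrix_mul_equiv, ← kronecker_reindex R.D g]
  rfl

theorem exists_block_equiv (ι : Type*) [Fintype ι] (hs : 0 < s) :
    ∃ (n : ℕ) (_ : s ∣ n), Nonempty (Fin (n / s) ≃ ι) :=
  ⟨Fintype.card ι * s, Dvd.intro_left _ rfl,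
    ⟨(finCongr (Nat.mul_div_cancel _ hs)).trans (Fintype.equivFin ι).symm⟩⟩

/-- The point `I ⊗ Y + W` as a tuple of matrices indexed by an initial segment of `ℕ`. -/
def pointOf (Y : Fin d → Matrix (Fin s) (Fin s) K) {n : ℕ} (h : s ∣ n) (g : Fin (n / s) ≃ ι)
    (W : Fin d → Matrix (ι × Fin s) (ι × Fin s) K) : Fin d → Matrix (Fin n) (Fin n) K :=
  fun k => ((1 : Matrix ι ι K) ⊗ₖ Y k + W k).submatrix
    ((blockEquiv h).symm.trans (g.prodCongr (Equiv.refl (Fin s))))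
    ((blockEquiv h).symm.trans (g.prodCongr (Equiv.refl (Fin s))))

variable {Y : Fin d → Matrix (Fin s) (Fin s) K}

theorem shifted_pointOf {n : ℕ} (h : s ∣ n) (g : Fin (n / s) ≃ ι)
    (W : Fin d → Matrix (ι × Fin s) (ι × Fin s) K) :
    shifted Y h (pointOf Y h g W) = fun k => (W k).submatrix (g.prodCongr (Equiv.refl (Fin s)))
      (g.prodCongr (Equiv.refl (Fin s))) := by
  funext k
  rw [shifted, pointOf, ← kronecker_reindex (Y k) g, sub_eq_iff_eq_add']
  ext x y
  simp

theorem StrictlyRanked.jointlyNilpotent {n : ℕ} (h : s ∣ n) (g : Fin (n / s) ≃ ι) {r : ι → ℕ}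
    {W : Fin d → Matrix (ι × Fin s) (ι × Fin s) K} (hW : StrictlyRanked r W) :
    JointlyNilpotent (centered Y h (pointOf Y h g W)) := by
  rw [centered_eq_blocks, shifted_pointOf]
  exact jointlyNilpotent_of_rank (r ∘ g) fun k i j hij => hW k (g i) (g j) hij

variable [Fintype ι]

theorem StrictlyRanked.isUnit (hs : 0 < s) (R : FMRealization K s d L) {r : ι → ℕ}
    {W : Fin d → Matrix (ι × Fin s) (ι × Fin s) K} (hW : StrictlyRanked r W) :
    IsUnit (1 - amp R.sumA W) := by
  obtain ⟨n, h, ⟨g⟩⟩ := exists_block_equiv (s := s) ι hs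
  -- The centre is irrelevant to the conclusion, so 0 serves.
  have := hW.jointlyNilpotent (Y := 0) h g
  rw [centered_eq_blocks] at this
  have := R.isUnit_one_sub_amp _ this
  rw [shifted_pointOf, one_sub_amp_reindex] at this
  exact (Matrix.isUnit_submatrix_equiv _ _).1 this

/-- Similarity invariance of the transfer function at triangular points, for a series that is a
nc function. -/
theorem transfer_similarity (hs : 0 < s) {f : GenPowerSeries K s d}
    (hnc : IsNCFunctionOn (Nilp Y) (f.eval Y)) {R : FMRealization K s d L} (hf : f.Admits R)
    [Nonempty ι] {r r' : ι → ℕ} {W W' : Fin d → Matrix (ι × Fin s) (ι × Fin s) K}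
    (hW : StrictlyRanked r W) (hW' : StrictlyRanked r' W')
    (T : (Matrix (ι × Fin s) (ι × Fin s) K)ˣ)
    (hT : ∀ k, ((1 : Matrix ι ι K) ⊗ₖ Y k + W' k) * T.val =
      T.val * ((1 : Matrix ι ι K) ⊗ₖ Y k + W k)) :
    R.transfer W' * T.val = T.val * R.transfer W := by
  obtain ⟨n, h, ⟨g⟩⟩ := exists_block_equiv (s := s) ι hs
  have hn : 0 < n := by
    rcases Nat.eq_zero_or_pos n with rfl | hn
    · obtain ⟨i⟩ := ‹Nonempty ι›
      exact absurd (g.symm i).2 (by simp)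
    · exact hn
  let e := (blockEquiv h).symm.trans (g.prodCongr (Equiv.refl (Fin s)))
  let U : (Matrix (Fin n) (Fin n) K)ˣ :=
    ⟨T.val.submatrix e e, (T⁻¹).val.submatrix e e,
      by rw [Matrix.submatrix_mul_equiv, T.mul_inv, Matrix.submatrix_one_equiv],
      by rw [Matrix.submatrix_mul_equiv, T.inv_mul, Matrix.submatrix_one_equiv]⟩
  have hconj : (fun k => U.val * pointOf Y h g W k * (U⁻¹).val) = pointOf Y h g W' := by
    funext k
    rw [Units.mul_inv_eq_iff_eq_mul]
    change T.val.submatrix e e * Matrix.submatrix _ e e =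
      Matrix.submatrix _ e e * T.val.submatrix e e
    rw [Matrix.submatrix_mul_equiv, Matrix.submatrix_mul_equiv, hT]
  have hX : pointOf Y h g W ∈ Nilp Y n := ⟨hn, h, hW.jointlyNilpotent h g⟩
  have hX' : pointOf Y h g W' ∈ Nilp Y n := ⟨hn, h, hW'.jointlyNilpotent h g⟩
  have := hnc.map_similarity n _ U hX (by rw [hconj]; exact hX')
  rw [hconj, Units.eq_mul_inv_iff_mul_eq] at this
  have heval {V : Fin d → Matrix (ι × Fin s) (ι × Fin s) K} {r : ι → ℕ}
      (hV : StrictlyRanked r V) :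
      f.eval Y n (pointOf Y h g V) = (R.transfer V).submatrix e e := by
    have := eval_submatrix hf h (hV.jointlyNilpotent (Y := Y) h g)
    rw [shifted_pointOf, FMRealization.transfer_reindex] at this
    ext i j
    simpa [e] using congrFun (congrFun this ((blockEquiv h).symm i)) ((blockEquiv h).symm j)
  rw [heval hW, heval hW'] at this
  change Matrix.submatrix _ e e * T.val.submatrix e e =
    T.val.submatrix e e * Matrix.submatrix _ e e at this
  rw [Matrix.submatrix_mul_equiv, Matrix.submatrix_mul_equiv] at this
  ext x y
  simpa using congrFun (congrFun this (e.symm x)) (e.symm y)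

end Triangular

/-! ### Elementary similarities -/

section Elementary

variable {K : Type*} {s d L : ℕ} {ι : Type*}

/-- The tuple of block matrices with prescribed blocks. -/
def ofTuples (w : ι → ι → Fin d → Matrix (Fin s) (Fin s) K) :
    Fin d → Matrix (ι × Fin s) (ι × Fin s) K :=
  fun k => Matrix.of fun x y => w x.1 y.1 k x.2 y.2

theorem tblk_ofTuples (w : ι → ι → Fin d → Matrix (Fin s) (Fin s) K) (i j : ι) :
    tblk (ofTuples w) i j = w i j := rfl

theorem blk_ofTuples (w : ι → ι → Fin d → Matrix (Fin s) (Fin s) K) (i j : ι) (k : Fin d) :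
    blk (ofTuples w k) i j = w i j k := rfl

variable [Field K] [DecidableEq ι]

/-- The block matrix with a single block `S` in position `(P, Q)`. -/
def singleBlk (P Q : ι) (S : Matrix (Fin s) (Fin s) K) : Matrix (ι × Fin s) (ι × Fin s) K :=
  Matrix.of fun x y => if x.1 = P ∧ y.1 = Q then S x.2 y.2 else 0

theorem blk_singleBlk (P Q : ι) (S : Matrix (Fin s) (Fin s) K) (i j : ι) :
    blk (singleBlk P Q S) i j = if i = P ∧ j = Q then S else 0 := by
  ext a b
  by_cases h : i = P ∧ j = Q <;> simp [blk, singleBlk, h]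

variable [Fintype ι]

theorem blk_singleBlk_mul (P Q : ι) (S : Matrix (Fin s) (Fin s) K)
    (M : Matrix (ι × Fin s) (ι × Fin s) K) (i j : ι) :
    blk (singleBlk P Q S * M) i j = if i = P then S * blk M Q j else 0 := by
  rw [blk_mul, Fintype.sum_eq_single Q]
  · by_cases h : i = P <;> simp [blk_singleBlk, h]
  · intro k hk
    simp [blk_singleBlk, hk]

theorem blk_mul_singleBlk (P Q : ι) (S : Matrix (Fin s) (Fin s) K)
    (M : Matrix (ι × Fin s) (ι × Fin s) K) (i j : ι) :
    blk (M * singleBlk P Q S) i j = if j = Q then blk M i P * S else 0 := by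
  rw [blk_mul, Fintype.sum_eq_single P]
  · by_cases h : j = Q <;> simp [blk_singleBlk, h]
  · intro k hk
    simp [blk_singleBlk, hk]

/-- The transvection `1 + S ⊗ E_{PQ}`. -/
def transvectionUnit {P Q : ι} (hPQ : P ≠ Q) (S : Matrix (Fin s) (Fin s) K) :
    (Matrix (ι × Fin s) (ι × Fin s) K)ˣ where
  val := 1 + singleBlk P Q S
  inv := 1 - singleBlk P Q S
  val_inv := by
    have : singleBlk P Q S * singleBlk P Q S = 0 := blk_ext fun i j => by
      simp [blk_singleBlk_mul, blk_singleBlk, hPQ.symm]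
    rw [mul_sub, add_mul _ _ (singleBlk P Q S), this]; simp
  inv_val := by
    have : singleBlk P Q S * singleBlk P Q S = 0 := blk_ext fun i j => by
      simp [blk_singleBlk_mul, blk_singleBlk, hPQ.symm]
    rw [mul_add, sub_mul _ _ (singleBlk P Q S), this]; simp

namespace FMRealization

variable (R : FMRealization K s d L) (Y : Fin d → Matrix (Fin s) (Fin s) K)

/-! ### Trivial arguments at which the defects vanish. -/

section
variable (w z : Fin d → Matrix (Fin s) (Fin s) K) (S : Matrix (Fin s) (Fin s) K)

theorem defectD_zero : R.defectD Y 0 = 0 := by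
  have : (fun _ => 0 : Fin d → Matrix (Fin s) (Fin s) K) = 0 := rfl
  simp [defectD, this]

/-- The identity commutes with each Y_k, so the commutator term drops out and the other two terms
cancel. This disposes of the diagonal blocks of a transvection. -/
theorem defectD_one : R.defectD Y 1 = 0 := by
  have : (fun _ => 0 : Fin d → Matrix (Fin s) (Fin s) K) = 0 := rfl
  simp [defectD, this]

theorem defectCB_zero : R.defectCB Y 0 w = 0 := by
  have : (fun _ => 0 : Fin d → Matrix (Fin s) (Fin s) K) = 0 := rfl
  simp [defectCB, this]

theorem defectCB_one : R.defectCB Y 1 w = 0 := by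
  have : (fun _ => 0 : Fin d → Matrix (Fin s) (Fin s) K) = 0 := rfl
  simp [defectCB, this]

theorem defectCA_zero : R.defectCA Y 0 w = 0 := by
  have : (fun _ => 0 : Fin d → Matrix (Fin s) (Fin s) K) = 0 := rfl
  simp [defectCA, this]

theorem defectCA_one : R.defectCA Y 1 w = 0 := by
  have : (fun _ => 0 : Fin d → Matrix (Fin s) (Fin s) K) = 0 := rfl
  simp [defectCA, this]

theorem defectB_zero : R.defectB Y w 0 = 0 := by
  have : (fun _ => 0 : Fin d → Matrix (Fin s) (Fin s) K) = 0 := rfl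
  simp [defectB, this]

theorem defectB_one : R.defectB Y w 1 = 0 := by
  have : (fun _ => 0 : Fin d → Matrix (Fin s) (Fin s) K) = 0 := rfl
  simp [defectB, this]

theorem defectAB_zero : R.defectAB Y w 0 z = 0 := by
  have : (fun _ => 0 : Fin d → Matrix (Fin s) (Fin s) K) = 0 := rfl
  simp [defectAB, this]

theorem defectAB_one : R.defectAB Y w 1 z = 0 := by
  have : (fun _ => 0 : Fin d → Matrix (Fin s) (Fin s) K) = 0 := rfl
  simp [defectAB, this]

theorem defectAA_zero : R.defectAA Y w 0 z = 0 := by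
  have : (fun _ => 0 : Fin d → Matrix (Fin s) (Fin s) K) = 0 := rfl
  simp [defectAA, this]

theorem defectAA_one : R.defectAA Y w 1 z = 0 := by
  have : (fun _ => 0 : Fin d → Matrix (Fin s) (Fin s) K) = 0 := rfl
  simp [defectAA, this]

theorem defectCB_tuple_zero : R.defectCB Y S 0 = 0 := by
  have : (fun _ => 0 : Fin d → Matrix (Fin s) (Fin s) K) = 0 := rfl
  simp [defectCB, this]

theorem defectCA_tuple_zero : R.defectCA Y S 0 = 0 := by
  have : (fun _ => 0 : Fin d → Matrix (Fin s) (Fin s) K) = 0 := rfl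
  simp [defectCA, this]

theorem defectB_tuple_zero : R.defectB Y 0 S = 0 := by
  have : (fun _ => 0 : Fin d → Matrix (Fin s) (Fin s) K) = 0 := rfl
  simp [defectB, this]

theorem defectAB_left_zero : R.defectAB Y 0 S z = 0 := by
  have : (fun _ => 0 : Fin d → Matrix (Fin s) (Fin s) K) = 0 := rfl
  simp [defectAB, this]

theorem defectAB_right_zero : R.defectAB Y w S 0 = 0 := by
  have : (fun _ => 0 : Fin d → Matrix (Fin s) (Fin s) K) = 0 := rfl
  simp [defectAB, this]

theorem defectAA_left_zero : R.defectAA Y 0 S z = 0 := by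
  have : (fun _ => 0 : Fin d → Matrix (Fin s) (Fin s) K) = 0 := rfl
  simp [defectAA, this]

theorem defectAA_right_zero : R.defectAA Y w S 0 = 0 := by
  have : (fun _ => 0 : Fin d → Matrix (Fin s) (Fin s) K) = 0 := rfl
  simp [defectAA, this]

end

theorem ite_transvection {N : Type*} [AddCommMonoid N] {P Q : ι} (hPQ : P ≠ Q)
    (S : Matrix (Fin s) (Fin s) K) (φ : Matrix (Fin s) (Fin s) K → N) (h0 : φ 0 = 0)
    (h1 : φ 1 = 0) (i j : ι) :
    φ (blk (transvectionUnit hPQ S).val i j) = if i = P ∧ j = Q then φ S else 0 := by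
  simp only [transvectionUnit, blk_add, blk_one, blk_singleBlk]
  by_cases h : i = P ∧ j = Q
  · obtain ⟨rfl, rfl⟩ := h
    simp [hPQ]
  · rw [if_neg h, if_neg h, add_zero]
    split_ifs <;> assumption

/-- The intertwining identity at a strictly triangular point, for an elementary similarity. -/
theorem transvection_identity (hs : 0 < s) {Y} {f : GenPowerSeries K s d}
    (hnc : IsNCFunctionOn (Nilp Y) (f.eval Y)) {R : FMRealization K s d L} (hf : f.Admits R)
    (r : ι → ℕ) (w : ι → ι → Fin d → Matrix (Fin s) (Fin s) K)
    (hw : ∀ i j, r j ≤ r i → w i j = 0) {P Q : ι} (hPQ : r P < r Q)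
    (S : Matrix (Fin s) (Fin s) K) (i₀ l₀ : ι) :
    ∃ (ρ : ι → Matrix (Fin s) (Fin L) K) (c : ι → Matrix (Fin L) (Fin s) K),
      (∀ j, j ≠ Q → w Q j = 0 → ρ j = (if i₀ = j then R.C else 0) + ∑ i, ρ i * R.sumA (w i j)) ∧
      (∀ i, c i = R.sumB (w i l₀) + ∑ j, R.sumA (w i j) * c j) ∧
      (if i₀ = P ∧ l₀ = Q then R.defectD Y S else 0) +
        (if i₀ = P then R.defectCB Y S (w Q l₀) else 0) +
        (if i₀ = P then ∑ m, R.defectCA Y S (w Q m) * c m else 0) +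
        (if l₀ = Q then ∑ n, ρ n * R.defectB Y (w n P) S else 0) +
        ∑ n, ρ n * R.defectAB Y (w n P) S (w Q l₀) +
        ∑ m, (∑ n, ρ n * R.defectAA Y (w n P) S (w Q m)) * c m = 0 := by
  have hne : P ≠ Q := fun h => by rw [h] at hPQ; omega
  have : Nonempty ι := ⟨P⟩
  let E := singleBlk P Q S
  let V : Fin d → Matrix (ι × Fin s) (ι × Fin s) K :=
    fun k => (1 : Matrix ι ι K) ⊗ₖ Y k + ofTuples w k
  -- I ⊗ Y + W' is the conjugate (1 + E)V(1 - E). The term EVE is absent because the (Q, P) block of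
  -- V is zero. As P has smaller rank than Q, W' is again strictly triangular for `r`.
  let W' : Fin d → Matrix (ι × Fin s) (ι × Fin s) K :=
    fun k => ofTuples w k + E * V k - V k * E
  have hW : StrictlyRanked r (ofTuples w) := fun k i j hij => by rw [blk_ofTuples, hw i j hij]; rfl
  have hV (k i j) : blk (V k) i j = (if i = j then Y k else 0) + w i j k := by
    simp only [V, blk_add, blk_kronecker, blk_ofTuples]
  have hW' : StrictlyRanked r W' := by
    intro k i j hij
    simp only [W', E, blk_sub, blk_add, blk_singleBlk_mul, blk_mul_singleBlk, hV, hW k i j hij]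
    have e1 : i = P → Q ≠ j ∧ w Q j = 0 := by
      rintro rfl
      exact ⟨by rintro rfl; omega, hw _ _ (by omega)⟩
    have e2 : j = Q → i ≠ P ∧ w i P = 0 := by
      rintro rfl
      exact ⟨by rintro rfl; omega, hw _ _ (by omega)⟩
    by_cases hi : i = P <;> by_cases hj : j = Q
    · exact absurd hi (e2 hj).1
    · simp [hi, hj, e1 hi]
    · simp [hi, hj, e2 hj]
    · simp [hi, hj]
  have hT (k) : ((1 : Matrix ι ι K) ⊗ₖ Y k + W' k) * (transvectionUnit hne S).val =
      (transvectionUnit hne S).val * ((1 : Matrix ι ι K) ⊗ₖ Y k + ofTuples w k) := by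
    have h1 : (1 : Matrix ι ι K) ⊗ₖ Y k + W' k = V k + E * V k - V k * E := by
      simp only [W', V]; abel
    have h2 : V k * E * E = 0 := blk_ext fun i j => by
      simp [E, blk_mul_singleBlk, hne]
    have h3 : E * V k * E = 0 := blk_ext fun i j => by
      simp [E, blk_mul_singleBlk, blk_singleBlk_mul, hV, hne.symm, hw Q P hPQ.le]
    rw [h1]
    change (V k + E * V k - V k * E) * (1 + E) = (1 + E) * V k
    rw [mul_add, sub_mul (V k + E * V k) (V k * E) E, add_mul (V k) (E * V k) E, h2, h3,
      add_mul 1 E (V k), one_mul, mul_one]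
    abel
  have hU := hW.isUnit hs R
  have hU' := hW'.isUnit hs R
  -- Conjugation changes only block row P, by S times row Q of V, and block column Q. Columns
  -- avoiding both changes are those of `w`, so the row of the resolvent of W' obeys a recursion in
  -- `w` there.
  have hcol (n j) (hj : j ≠ Q) (hQj : w Q j = 0) : tblk W' n j = w n j := by
    funext k
    simp only [tblk, W', E, blk_sub, blk_add, blk_singleBlk_mul, blk_mul_singleBlk, hV, hQj,
      blk_ofTuples, if_neg hj, if_neg hj.symm]
    simp
  set ρ := ((1 : Matrix ι ι K) ⊗ₖ R.C) * (1 - amp R.sumA W')⁻¹ with hρ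
  set c := (1 - amp R.sumA (ofTuples w))⁻¹ * amp R.sumB (ofTuples w) with hc
  have hρ' : ρ = ((1 : Matrix ι ι K) ⊗ₖ R.C) + ρ * amp R.sumA W' := by
    have : ρ * (1 - amp R.sumA W') = (1 : Matrix ι ι K) ⊗ₖ R.C := by
      rw [hρ, Matrix.mul_assoc,
        Matrix.nonsing_inv_mul _ ((Matrix.isUnit_iff_isUnit_det _).1 hU'), Matrix.mul_one]
    rw [← this, Matrix.mul_sub, Matrix.mul_one, sub_add_cancel]
  have hc' : c = amp R.sumB (ofTuples w) + amp R.sumA (ofTuples w) * c := by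
    have : (1 - amp R.sumA (ofTuples w)) * c = amp R.sumB (ofTuples w) := by
      rw [hc, ← Matrix.mul_assoc,
        Matrix.mul_nonsing_inv _ ((Matrix.isUnit_iff_isUnit_det _).1 hU), Matrix.one_mul]
    rw [← this, Matrix.sub_mul, Matrix.one_mul, sub_add_cancel]
  refine ⟨fun j => blk ρ i₀ j, fun i => blk c i l₀, fun j hj hQj => ?_, fun i => ?_, ?_⟩
  · have := congrArg (fun M => blk M i₀ j) hρ'
    simpa only [blk_add, blk_kronecker, blk_mul, blk_amp, hcol _ _ hj hQj] using this
  · have := congrArg (fun M => blk M i l₀) hc'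
    simpa only [blk_add, blk_mul, blk_amp, tblk_ofTuples] using this
  · have key := blk_transfer_mul_sub R Y (ofTuples w) W' (transvectionUnit hne S).val hT hU hU' i₀ l₀
    rw [transfer_similarity hs hnc hf hW hW' (transvectionUnit hne S) hT, sub_self, blk_zero,
      eq_comm, neg_eq_zero, ← hρ, ← hc] at key
    have e1 := ite_transvection hne S (R.defectD Y) (R.defectD_zero Y) (R.defectD_one Y)
    have e2 (x) := ite_transvection hne S (fun S => R.defectCB Y S x) (R.defectCB_zero Y x)
      (R.defectCB_one Y x)
    have e3 (x) := ite_transvection hne S (fun S => R.defectCA Y S x) (R.defectCA_zero Y x)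
      (R.defectCA_one Y x)
    have e4 (x) := ite_transvection hne S (R.defectB Y x) (R.defectB_zero Y x)
      (R.defectB_one Y x)
    have e5 (x z) := ite_transvection hne S (fun S => R.defectAB Y x S z) (R.defectAB_zero Y x z)
      (R.defectAB_one Y x z)
    have e6 (x z) := ite_transvection hne S (fun S => R.defectAA Y x S z) (R.defectAA_zero Y x z)
      (R.defectAA_one Y x z)
    simp only [e1, e2, e3, e4, e5, e6, ite_and, Finset.sum_ite_irrel, Finset.sum_const_zero,
      Finset.sum_ite_eq', Finset.mem_univ, if_true, tblk_ofTuples,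
      hcol _ P hne (hw Q P hPQ.le)] at key
    by_cases hi : i₀ = P <;> by_cases hl : l₀ = Q <;>
      simpa only [hi, hl, if_true, if_false, and_self, and_true, and_false, Matrix.zero_mul,
        Matrix.mul_zero, Finset.sum_const_zero] using key

end FMRealization
end Elementary

end NCReal

namespace NCReal

/-! ### Necessity of the lost-abbey conditions -/

namespace FMRealization

variable {K : Type*} [Field K] {s d L : ℕ} (R : FMRealization K s d L)

/-- `A(w 0) ⋯ A(w (n - 1))` -/
def chainA (w : ℕ → Fin d → Matrix (Fin s) (Fin s) K) : ℕ → Matrix (Fin L) (Fin L) K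
  | 0 => 1
  | n + 1 => chainA w n * R.sumA (w n)

/-- `A(w n) ⋯ A(w 1) B(w 0)` -/
def chainB (w : ℕ → Fin d → Matrix (Fin s) (Fin s) K) : ℕ → Matrix (Fin L) (Fin s) K
  | 0 => R.sumB (w 0)
  | n + 1 => R.sumA (w (n + 1)) * chainB w n

theorem chainA_congr {w w' : ℕ → Fin d → Matrix (Fin s) (Fin s) K} {n : ℕ}
    (h : ∀ t < n, w t = w' t) : R.chainA w n = R.chainA w' n := by
  induction n with
  | zero => rfl
  | succ n ih => rw [chainA, chainA, ih fun t ht => h t (by omega), h n (by omega)]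

theorem chainB_congr {w w' : ℕ → Fin d → Matrix (Fin s) (Fin s) K} {n : ℕ}
    (h : ∀ t ≤ n, w t = w' t) : R.chainB w n = R.chainB w' n := by
  induction n with
  | zero => rw [chainB, chainB, h 0 le_rfl]
  | succ n ih => rw [chainB, chainB, ih fun t ht => h t (by omega), h (n + 1) le_rfl]

/-- Tuples supported at one letter recover the words, so testing against chains covers the products
in `Observable`; `exists_chainB` does the same for `Controllable`. -/
theorem exists_chainA {ℓ : ℕ} (i : Fin ℓ → Fin d) (Z : Fin ℓ → Matrix (Fin s) (Fin s) K) :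
    ∃ w, R.chainA w ℓ = R.wordA i Z := by
  induction ℓ with
  | zero => exact ⟨0, by simp [chainA, wordA]⟩
  | succ ℓ ih =>
    obtain ⟨w, hw⟩ := ih (fun j => i j.castSucc) (fun j => Z j.castSucc)
    refine ⟨Function.update w ℓ (Pi.single (i (Fin.last ℓ)) (Z (Fin.last ℓ))), ?_⟩
    rw [chainA, wordA_succ, ← hw, Function.update_self, sumA_single]
    congr 1
    exact R.chainA_congr fun t ht => Function.update_of_ne (by omega) _ _

theorem exists_chainB {ℓ : ℕ} (i : Fin ℓ → Fin d) (Z : Fin ℓ → Matrix (Fin s) (Fin s) K)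
    (k : Fin d) (V : Matrix (Fin s) (Fin s) K) :
    ∃ w, R.chainB w ℓ = R.wordA i Z * R.B k V := by
  induction ℓ with
  | zero => exact ⟨fun _ => Pi.single k V, by simp [chainB, wordA, sumB_single]⟩
  | succ ℓ ih =>
    obtain ⟨w, hw⟩ := ih (fun j => i j.succ) (fun j => Z j.succ)
    refine ⟨Function.update w (ℓ + 1) (Pi.single (i 0) (Z 0)), ?_⟩
    have hA : R.wordA i Z = R.A (i 0) (Z 0) * R.wordA (fun j => i j.succ) fun j => Z j.succ := by
      simp only [wordA]
      rw [List.ofFn_succ, List.prod_cons]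
    rw [chainB, hA, Matrix.mul_assoc, ← hw, Function.update_self, sumA_single]
    congr 1
    exact R.chainB_congr fun t ht => Function.update_of_ne (by omega) _ _

variable {R}

theorem Observable.eq_zero (ho : R.Observable) {n : ℕ} {M : Matrix (Fin L) (Fin n) K}
    (h : ∀ ℓ w, R.C * R.chainA w ℓ * M = 0) : M = 0 := by
  have hv (v : Fin n → K) : M *ᵥ v = 0 := by
    have : M *ᵥ v ∈ (⊥ : Submodule K (Fin L → K)) := by
      rw [← ho]
      simp only [Submodule.mem_iInf, LinearMap.mem_ker, Matrix.mulVecLin_apply]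
      rintro ⟨ℓ, i⟩ Z
      obtain ⟨w, hw⟩ := R.exists_chainA i Z
      rw [← hw, Matrix.mulVec_mulVec, h, Matrix.zero_mulVec]
    simpa using this
  ext a b
  simpa using congrFun (hv (Pi.single b 1)) a

theorem Controllable.eq_zero (hc : R.Controllable) {n : ℕ} {M : Matrix (Fin n) (Fin L) K}
    (h : ∀ ℓ w, M * R.chainB w ℓ = 0) : M = 0 := by
  have hker : LinearMap.ker M.mulVecLin = ⊤ := by
    rw [eq_top_iff, ← hc]
    refine iSup_le fun ⟨ℓ, i⟩ => iSup_le fun Z => iSup_le fun k => iSup_le fun V => ?_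
    rintro _ ⟨v, rfl⟩
    obtain ⟨w, hw⟩ := R.exists_chainB i Z k V
    rw [LinearMap.mem_ker, Matrix.mulVecLin_apply, Matrix.mulVecLin_apply, ← hw,
      Matrix.mulVec_mulVec, h, Matrix.zero_mulVec]
  ext a b
  have : M *ᵥ Pi.single b 1 = 0 := by
    have : Pi.single b 1 ∈ LinearMap.ker M.mulVecLin := by rw [hker]; trivial
    simpa using this
  simpa using congrFun this a

/-- The tuples of blocks of the direct sum of two chains, of lengths `m₁` and `m₂`. -/
def twoChains (m₁ m₂ : ℕ) (w₁ w₂ : ℕ → Fin d → Matrix (Fin s) (Fin s) K) :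
    Fin (m₁ + 1) ⊕ Fin (m₂ + 1) → Fin (m₁ + 1) ⊕ Fin (m₂ + 1) →
      Fin d → Matrix (Fin s) (Fin s) K
  | .inl p, .inl q => if q.val = p.val + 1 then w₁ p else 0
  | .inr p, .inr q => if p.val = q.val + 1 then w₂ q else 0
  | _, _ => 0

/-- The second chain is numbered from its far end, so its rank falls as the index grows. The shift
by `m₁ + 1` puts it above the first chain, so that the bridge goes from rank `m₁` to rank `m₁ + 1`.
-/
def twoChainsRank (m₁ m₂ : ℕ) : Fin (m₁ + 1) ⊕ Fin (m₂ + 1) → ℕ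
  | .inl p => p
  | .inr q => m₁ + 1 + (m₂ - q)

theorem twoChains_eq_zero {m₁ m₂ : ℕ} (w₁ w₂ : ℕ → Fin d → Matrix (Fin s) (Fin s) K) (i j)
    (h : twoChainsRank m₁ m₂ j ≤ twoChainsRank m₁ m₂ i) : twoChains m₁ m₂ w₁ w₂ i j = 0 := by
  rcases i with p | p <;> rcases j with q | q <;> simp only [twoChains, twoChainsRank] at h ⊢
  · rw [if_neg (by omega)]
  · rw [if_neg (by omega)]

/-- The identity obtained from two chains: each defect is tested by products along the chains. -/
theorem chain_identity (hs : 0 < s) {Y : Fin d → Matrix (Fin s) (Fin s) K}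
    {f : GenPowerSeries K s d} (hnc : IsNCFunctionOn (Nilp Y) (f.eval Y)) (hf : f.Admits R)
    (m₁ m₂ : ℕ) (w₁ w₂ : ℕ → Fin d → Matrix (Fin s) (Fin s) K) (S : Matrix (Fin s) (Fin s) K) :
    ∃ (ρ : Fin (m₁ + 1) ⊕ Fin (m₂ + 1) → Matrix (Fin s) (Fin L) K)
      (c : Fin (m₁ + 1) ⊕ Fin (m₂ + 1) → Matrix (Fin L) (Fin s) K),
      (∀ p : Fin (m₁ + 1), ρ (.inl p) = R.C * R.chainA w₁ p) ∧
      c (.inr 0) = 0 ∧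
      (∀ (q : ℕ) (hq : q < m₂), c (.inr ⟨q + 1, by omega⟩) = R.chainB w₂ q) ∧
      (if (.inl 0 : Fin (m₁ + 1) ⊕ Fin (m₂ + 1)) = .inl (Fin.last m₁) ∧
          (.inr 0 : Fin (m₁ + 1) ⊕ Fin (m₂ + 1)) = .inr (Fin.last m₂) then
          R.defectD Y S else 0) +
        (if (.inl 0 : Fin (m₁ + 1) ⊕ Fin (m₂ + 1)) = .inl (Fin.last m₁) then
          R.defectCB Y S (twoChains m₁ m₂ w₁ w₂ (.inr (Fin.last m₂)) (.inr 0)) else 0) +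
        (if (.inl 0 : Fin (m₁ + 1) ⊕ Fin (m₂ + 1)) = .inl (Fin.last m₁) then
          ∑ m, R.defectCA Y S (twoChains m₁ m₂ w₁ w₂ (.inr (Fin.last m₂)) m) * c m else 0) +
        (if (.inr 0 : Fin (m₁ + 1) ⊕ Fin (m₂ + 1)) = .inr (Fin.last m₂) then
          ∑ n, ρ n * R.defectB Y (twoChains m₁ m₂ w₁ w₂ n (.inl (Fin.last m₁))) S else 0) +
        ∑ n, ρ n * R.defectAB Y (twoChains m₁ m₂ w₁ w₂ n (.inl (Fin.last m₁))) S
          (twoChains m₁ m₂ w₁ w₂ (.inr (Fin.last m₂)) (.inr 0)) +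
        ∑ m, (∑ n, ρ n * R.defectAA Y (twoChains m₁ m₂ w₁ w₂ n (.inl (Fin.last m₁))) S
          (twoChains m₁ m₂ w₁ w₂ (.inr (Fin.last m₂)) m)) * c m = 0 := by
  obtain ⟨ρ, c, hρ, hc, h⟩ := transvection_identity hs hnc hf (twoChainsRank m₁ m₂)
    (twoChains m₁ m₂ w₁ w₂) (twoChains_eq_zero w₁ w₂)
    (P := .inl (Fin.last m₁)) (Q := .inr (Fin.last m₂)) (by simp [twoChainsRank])
    S (.inl 0) (.inr 0)
  -- Row `inr 0` of the tuples is zero, since the second chain ends there.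
  have hc0 : c (.inr 0) = 0 := by
    rw [hc]
    simp [twoChains]
  refine ⟨ρ, c, fun ⟨p, hp⟩ => ?_, hc0, fun q => ?_, h⟩
  · induction p with
    | zero =>
      rw [hρ _ (by simp) rfl]
      simp [twoChains, chainA]
    | succ p ih =>
      rw [hρ _ (by simp) rfl, Fintype.sum_eq_single (.inl ⟨p, by omega⟩), ih (by omega)]
      · simp [twoChains, chainA, Matrix.mul_assoc, Fin.ext_iff]
      · rintro (⟨t, ht⟩ | t) hne
        · have : p ≠ t := by rintro rfl; exact hne rfl
          simp [twoChains, this]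
        · simp [twoChains]
  · induction q with
    | zero =>
      intro hq
      rw [hc, Fintype.sum_eq_single (.inr 0), hc0]
      · simp [twoChains, chainB]
      · rintro (t | ⟨t, ht⟩) hne
        · simp [twoChains]
        · have : t ≠ 0 := by rintro rfl; exact hne rfl
          simp [twoChains, this]
    | succ q ih =>
      intro hq
      rw [hc, Fintype.sum_eq_single (.inr ⟨q + 1, by omega⟩), ih (by omega)]
      · simp [twoChains, chainB]
      · rintro (t | ⟨t, ht⟩) hne
        · simp [twoChains]
        · have : q + 1 ≠ t := by rintro rfl; exact hne rfl
          simp [twoChains, this]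

/-! ### Sums over the neighbours of the two bridged nodes. -/

section Sums

variable (m₁ m₂ : ℕ) (w₁ w₂ : ℕ → Fin d → Matrix (Fin s) (Fin s) K)

theorem twoChains_inl_last (n : Fin (m₁ + 1 + 1) ⊕ Fin (m₂ + 1)) :
    twoChains (m₁ + 1) m₂ w₁ w₂ n (.inl (Fin.last (m₁ + 1))) =
      if n = .inl (Fin.last m₁).castSucc then w₁ m₁ else 0 := by
  rcases n with p | q
  · by_cases h : p = (Fin.last m₁).castSucc
    · simp [twoChains, h]
    · have : m₁ ≠ p.val := fun e => h (Fin.ext e.symm)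
      simp [twoChains, h, this]
  · simp [twoChains]

theorem twoChains_inr_last (m : Fin (m₁ + 1) ⊕ Fin (m₂ + 1 + 1)) :
    twoChains m₁ (m₂ + 1) w₁ w₂ (.inr (Fin.last (m₂ + 1))) m =
      if m = .inr (Fin.last m₂).castSucc then w₂ m₂ else 0 := by
  rcases m with p | q
  · simp [twoChains]
  · by_cases h : q = (Fin.last m₂).castSucc
    · simp [twoChains, h]
    · have : m₂ ≠ q.val := fun e => h (Fin.ext e.symm)
      simp [twoChains, h, this]

theorem sum_twoChains_inl {n : ℕ} (ρ : Fin (m₁ + 1 + 1) ⊕ Fin (m₂ + 1) → Matrix (Fin s) (Fin L) K)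
    (φ : (Fin d → Matrix (Fin s) (Fin s) K) → Matrix (Fin L) (Fin n) K) (hφ : φ 0 = 0) :
    ∑ n, ρ n * φ (twoChains (m₁ + 1) m₂ w₁ w₂ n (.inl (Fin.last (m₁ + 1)))) =
      ρ (.inl (Fin.last m₁).castSucc) * φ (w₁ m₁) := by
  simp only [twoChains_inl_last]
  rw [Fintype.sum_eq_single (.inl (Fin.last m₁).castSucc) fun x hx => by
    rw [if_neg hx, hφ, Matrix.mul_zero], if_pos rfl]

theorem sum_twoChains_inr {n : ℕ} (c : Fin (m₁ + 1) ⊕ Fin (m₂ + 1 + 1) → Matrix (Fin L) (Fin s) K)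
    (φ : (Fin d → Matrix (Fin s) (Fin s) K) → Matrix (Fin n) (Fin L) K) (hφ : φ 0 = 0) :
    ∑ m, φ (twoChains m₁ (m₂ + 1) w₁ w₂ (.inr (Fin.last (m₂ + 1))) m) * c m =
      φ (w₂ m₂) * c (.inr (Fin.last m₂).castSucc) := by
  simp only [twoChains_inr_last]
  rw [Fintype.sum_eq_single (.inr (Fin.last m₂).castSucc) fun x hx => by
    rw [if_neg hx, hφ, Matrix.zero_mul], if_pos rfl]

end Sums

theorem chainA_update (w : ℕ → Fin d → Matrix (Fin s) (Fin s) K) (n : ℕ)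
    (x : Fin d → Matrix (Fin s) (Fin s) K) : R.chainA (Function.update w n x) n = R.chainA w n :=
  R.chainA_congr fun _ ht => Function.update_of_ne ht.ne _ _

theorem chainB_update (w : ℕ → Fin d → Matrix (Fin s) (Fin s) K) (n : ℕ)
    (x : Fin d → Matrix (Fin s) (Fin s) K) :
    R.chainB (Function.update w (n + 1) x) n = R.chainB w n :=
  R.chainB_congr fun _ ht => Function.update_of_ne (by omega) _ _

/-! ### Isolating each defect by the lengths of the two chains. -/

section Necessity

variable (hs : 0 < s) {Y : Fin d → Matrix (Fin s) (Fin s) K} {f : GenPowerSeries K s d}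
  (hf : f.Admits R) (hnc : IsNCFunctionOn (Nilp Y) (f.eval Y))
  (S : Matrix (Fin s) (Fin s) K) (x z : Fin d → Matrix (Fin s) (Fin s) K)
include hs hf hnc

theorem defectD_eq_zero : R.defectD Y S = 0 := by
  obtain ⟨ρ, c, -, -, -, h⟩ := chain_identity hs hnc hf 0 0 0 0 S
  simpa [twoChains, defectCB_tuple_zero, defectCA_tuple_zero, defectB_tuple_zero,
    defectAB_left_zero, defectAA_left_zero] using h

theorem defectCB_eq_zero : R.defectCB Y S x = 0 := by
  -- With second length 1 the only neighbour of the bridge is `inr 0`, where `c` vanishes. This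
  -- kills the CA term and leaves CB.
  obtain ⟨ρ, c, -, hc0, -, h⟩ := chain_identity hs hnc hf 0 1 0 (fun _ => x) S
  simpa [twoChains, defectCB_tuple_zero, defectCA_tuple_zero, defectB_tuple_zero,
    defectAB_left_zero, defectAA_left_zero, hc0, Fin.sum_univ_two] using h

theorem defectCA_eq_zero (hctr : R.Controllable) : R.defectCA Y S x = 0 := by
  refine hctr.eq_zero fun ℓ w => ?_
  -- The test chain occupies indices 0 to ℓ and `x` is placed next to the bridge at ℓ + 1. The
  -- second length is at least 2, so no block joins the bridge to `inr 0` and the CB term is zero.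
  obtain ⟨ρ, c, -, -, hc, h⟩ := chain_identity hs hnc hf 0 (ℓ + 1 + 1) 0
    (Function.update w (ℓ + 1) x) S
  have hcℓ : c (.inr (Fin.last (ℓ + 1)).castSucc) = R.chainB w ℓ :=
    (hc ℓ (by omega)).trans (chainB_update w ℓ x)
  rw [sum_twoChains_inr _ _ _ _ _ _ (R.defectCA_tuple_zero Y S), hcℓ] at h
  simpa [twoChains, defectCB_tuple_zero, defectB_tuple_zero,
    defectAB_left_zero, defectAA_left_zero] using h

theorem defectB_eq_zero (hobs : R.Observable) : R.defectB Y x S = 0 := by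
  refine hobs.eq_zero fun ℓ w => ?_
  -- On the left the test chain occupies indices below ℓ and `x` is the last step before the bridge.
  obtain ⟨ρ, c, hρ, -, -, h⟩ := chain_identity hs hnc hf (ℓ + 1) 0 (Function.update w ℓ x) 0 S
  have hρℓ : ρ (.inl (Fin.last ℓ).castSucc) = R.C * R.chainA w ℓ :=
    (hρ _).trans (congrArg _ (chainA_update w ℓ x))
  rw [sum_twoChains_inl _ _ _ _ _ (fun y => R.defectB Y y S) (R.defectB_tuple_zero Y S),
    hρℓ] at h
  simpa [twoChains, defectAB_right_zero, defectAA_right_zero, Fin.ext_iff] using h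

theorem defectAB_eq_zero (hobs : R.Observable) : R.defectAB Y x S z = 0 := by
  refine hobs.eq_zero fun ℓ w => ?_
  obtain ⟨ρ, c, hρ, hc0, -, h⟩ := chain_identity hs hnc hf (ℓ + 1) 1 (Function.update w ℓ x)
    (fun _ => z) S
  have hρℓ : ρ (.inl (Fin.last ℓ).castSucc) = R.C * R.chainA w ℓ :=
    (hρ _).trans (congrArg _ (chainA_update w ℓ x))
  rw [sum_twoChains_inl _ _ _ _ _ (fun y => R.defectAB Y y S _) (R.defectAB_left_zero Y _ S),
    hρℓ, sum_twoChains_inr _ _ _ _ _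
      (fun t => ∑ n, ρ n * R.defectAA Y (twoChains _ _ _ _ n (.inl (Fin.last (ℓ + 1)))) S t)
      (by simp [defectAA_right_zero])] at h
  have hc0' : c (.inr (Fin.last 0).castSucc) = 0 := hc0
  rw [hc0', Matrix.mul_zero] at h
  simpa [twoChains, Fin.ext_iff] using h

theorem defectAA_eq_zero (hctr : R.Controllable) (hobs : R.Observable) :
    R.defectAA Y x S z = 0 := by
  refine hobs.eq_zero fun ℓ w => hctr.eq_zero fun ℓ' w' => ?_
  obtain ⟨ρ, c, hρ, -, hc, h⟩ := chain_identity hs hnc hf (ℓ + 1) (ℓ' + 1 + 1)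
    (Function.update w ℓ x) (Function.update w' (ℓ' + 1) z) S
  have hρℓ : ρ (.inl (Fin.last ℓ).castSucc) = R.C * R.chainA w ℓ :=
    (hρ _).trans (congrArg _ (chainA_update w ℓ x))
  have hcℓ : c (.inr (Fin.last (ℓ' + 1)).castSucc) = R.chainB w' ℓ' :=
    (hc ℓ' (by omega)).trans (chainB_update w' ℓ' z)
  rw [sum_twoChains_inr _ _ _ _ _
      (fun t => ∑ n, ρ n * R.defectAA Y (twoChains _ _ _ _ n (.inl (Fin.last (ℓ + 1)))) S t)
      (by simp [defectAA_right_zero]),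
    sum_twoChains_inl _ _ _ _ _ (fun y => R.defectAA Y y S _) (R.defectAA_left_zero Y _ S),
    hρℓ, hcℓ] at h
  simpa [twoChains, defectAB_right_zero, Fin.ext_iff] using h

theorem linearizedLostAbbey (hctr : R.Controllable) (hobs : R.Observable) :
    R.LinearizedLostAbbey Y := by
  have hsingle_mul (S Z : Matrix (Fin s) (Fin s) K) (i : Fin d) :
      (fun k => S * (Pi.single i Z : Fin d → Matrix (Fin s) (Fin s) K) k) =
        Pi.single i (S * Z) := by
    funext k
    rcases eq_or_ne k i with rfl | hk <;> simp [*]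
  have hmul_single (S Z : Matrix (Fin s) (Fin s) K) (i : Fin d) :
      (fun k => (Pi.single i Z : Fin d → Matrix (Fin s) (Fin s) K) k * S) =
        Pi.single i (Z * S) := by
    funext k
    rcases eq_or_ne k i with rfl | hk <;> simp [*]
  refine ⟨fun S => ?_, fun S Z i => ?_, fun S Z i => ?_, fun S Z i => ?_, fun S Z₁ Z₂ i j => ?_,
    fun S Z₁ Z₂ i j => ?_⟩
  · simpa only [defectD, sumB_apply, sub_eq_zero] using defectD_eq_zero hs hf hnc S
  · simpa only [defectCB, hsingle_mul, sumB_single, sumA_apply, sub_eq_zero] using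
      defectCB_eq_zero hs hf hnc S (Pi.single i Z)
  · simpa only [defectCA, hsingle_mul, sumA_single, sumA_apply R fun k => S * Y k - Y k * S,
      sub_eq_zero] using defectCA_eq_zero hs hf hnc S (Pi.single i Z) hctr
  · simpa only [defectB, hmul_single, sumB_single, sumA_single,
      sumB_apply R fun k => S * Y k - Y k * S, sub_eq_zero] using
      defectB_eq_zero hs hf hnc S (Pi.single i Z) hobs
  · simpa only [defectAB, hmul_single, hsingle_mul, sumB_single, sumA_single,
      sumA_apply R fun k => S * Y k - Y k * S, sub_eq_zero] using
      defectAB_eq_zero hs hf hnc S (Pi.single i Z₁) (Pi.single j Z₂) hobs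
  · simpa only [defectAA, hmul_single, hsingle_mul, sumA_single,
      sumA_apply R fun k => S * Y k - Y k * S, sub_eq_zero] using
      defectAA_eq_zero hs hf hnc S (Pi.single i Z₁) (Pi.single j Z₂) hctr hobs

end Necessity

end FMRealization
end NCReal

theorem mainTheorem8 {K : Type*} [Field K] {s d L : ℕ}
    (Y : Fin d → Matrix (Fin s) (Fin s) K)
    (f : NCReal.GenPowerSeries K s d) (R : NCReal.FMRealization K s d L)
    (hfR : f.Admits R) (hc : R.Controllable) (ho : R.Observable) :
    NCReal.IsNCFunctionOn (NCReal.Nilp Y) (f.eval Y) ↔ R.LinearizedLostAbbey Y := by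
  refine ⟨fun hnc => ?_, fun hR => hR.isNCFunctionOn hfR⟩
  -- For s = 0 the nilpotent ball is empty and gives no information, but the conditions hold
  -- trivially: five compare empty matrices, and the last, of size L × L, holds because every A_k is
  -- zero.
  rcases Nat.eq_zero_or_pos s with rfl | hs
  · have hA (i Z) : R.A i Z = 0 := by rw [Subsingleton.elim Z 0, map_zero]
    constructor <;> intros
    · exact Subsingleton.elim _ _
    · exact Subsingleton.elim _ _
    · exact Subsingleton.elim _ _
    · exact Subsingleton.elim _ _
    · exact Subsingleton.elim _ _
    · simp [hA]
  · exact NCReal.FMRealization.linearizedLostAbbey hs hfR hnc hc ho
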